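/- **Setting.** For a finite measure $\nu$ on $[0,\infty)$ write $q_\nu(\alpha)=\inf\{y\ge 0:\ \nu([0,y])\ge\alpha\}$ for its quantile function. Let $\mathrm{unif}$ be the uniform probability measure on $[0,2\pi)$, and identify a measure $\nu\otimes\mathrm{unif}$ with its image on $\mathbb C$ under $(\rho,\theta)\mapsto \rho e^{i\theta}$. The empirical measure of a finite family of points, counted with multiplicity, is the uniform probability measure on that family; convergence of measures is weak convergence. **Theorem 4.1.** Let $\nu_0$ be a compactly supported probability measure on $[0,\infty)$. For $t\in[0,1)$ let $\nu_t$ be the law of $$\Bigl(1-\frac{t}{V_t}\Bigr)\,q_{\nu_0}(V_t),\qquad V_t \text{ uniform on } [t,1]$$ (for $t=0$ this is $\nu_0$ itself), so that $(1-t)\nu_t$ has total mass $1-t$, and put $\Psi_t(x)=(1-t)\,\nu_t([0,x])$. 1. *Convergence.* For each $n\ge 1$ let $0\le r^{(n)}_1\le\dots\le r^{(n)}_n$ be such that $\frac1n\sum_{j=1}^n\delta_{r^{(n)}_j}\to\nu_0$, and let $(m_n)$ be a sequence of positive integers with $m_n/(n\log n)\to\infty$. Let $P_{n,m}(z)=\prod_{j=1}^n\bigl(z^m-(r_j^{(n)})^m\bigr)$.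 Then for every $t\in(0,1)$ the empirical measure of the roots of the $\lfloor n m_n t\rfloor$-th derivative of $P_{n,m_n}$ converges to $\nu_t\otimes\mathrm{unif}$ as $n\to\infty$. 2. *Quantiles.* For every $t\in(0,1)$ and $0\le x\le 1-t$, $$q_{(1-t)\nu_t}(x)=\frac{x\,q_{\nu_0}(x+t)}{x+t}.$$ 3. *Continuous strictly increasing distribution function.* Suppose that for some $A>0$ the distribution function $\Psi_0$ of $\nu_0$ is a continuous and strictly increasing bijection from $[0,A]$ to $[0,1]$. Then $q_{\nu_0}:[0,1]\to[0,A]$ is its inverse bijection, and for every $t\in(0,1)$, $\Psi_t$ is a continuous and strictly increasing bijection from $[0,A(1-t)]$ to $[0,1-t]$, with inverse bijection $q_{(1-t)\nu_t}:[0,1-t]\to[0,A(1-t)]$. Hence, writing $\Psi^{\langle -1\rangle}$ for the inverse, $$\frac{\Psi_t^{\langle-1\rangle}(x)}{x}=\frac{\Psi_0^{\langle-1\rangle}(x+t)}{x+t},\qquad 0<x<1-t.$$ 4. *Continuous positive density.* Suppose that for some $A>0$, $\nu_0$ is absolutely continuous with respect to the Lebesgue measure on $[0,A]$, with a density that is continuous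 and strictly positive on $(0,A)$. Then for every $t\in[0,1)$ the measure $(1-t)\nu_t$ is carried by $[0,A(1-t)]$, $\Psi_t$ is continuous, and $\Psi_t$ has on $(0,A(1-t))$ a strictly positive derivative $x\mapsto\psi(x,t)$, which is a density of $(1-t)\nu_t$ with respect to the Lebesgue measure. Moreover $(t,x)\mapsto\Psi_t(x)$ is continuously differentiable on $$S=\{(t,x)\in[0,1)\times\mathbb R:\ 0<x<A(1-t)\}$$ (with one-sided $t$-derivatives at $t=0$), and on $S$ $$\frac{\partial\Psi_t(x)}{\partial t}=x\,\frac{\partial\Psi_t(x)/\partial x}{\Psi_t(x)}-1 .$$ 5. *$C^1$ density.* If in addition to the assumptions of 4 the density of $\nu_0$ is continuously differentiable on $(0,A)$, then $\psi$ is a continuously differentiable function of two variables on $S$, and on $S$ $$\frac{\partial\psi}{\partial t}(x,t)=\frac{\partial}{\partial x}\left(\frac{\psi(x,t)}{\frac1x\int_0^x\psi(y,t)\,dy}\right).$$ -/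

import Mathlib

open Set Filter Topology MeasureTheory Polynomial

noncomputable section

namespace RotDeriv

/-- A finite measure as an element of the space of finite measures, which carries the topology of
weak convergence. -/
def toFin {E : Type*} [MeasurableSpace E] (μ : Measure E) [h : IsFiniteMeasure μ] :
    FiniteMeasure E :=
  ⟨μ, h⟩

/-- The empirical probability measure `(1 / #s) ∑_{x ∈ s} δ_x` of a finite family of points counted
with multiplicity (the zero measure if the family is empty). -/
def empirical {E : Type*} [MeasurableSpace E] (s : Multiset E) : FiniteMeasure E :=
  (s.card : NNReal)⁻¹ • (s.map fun x => toFin (Measure.dirac x)).sum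

/-- The polynomial `P_{n,m}(z) = ∏_{j=1}^n (z^m - r_j^m)`. -/
def samplePoly {n : ℕ} (r : Fin n → ℝ) (m : ℕ) : ℂ[X] :=
  ∏ j : Fin n, (X ^ m - C ((r j : ℂ) ^ m))

/-- The quantile function `q_ν(α) = inf {y ≥ 0 : ν([0, y]) ≥ α}` of a finite measure. -/
def quantile (ν : Measure ℝ) (α : ℝ) : ℝ :=
  sInf {y : ℝ | 0 ≤ y ∧ α ≤ ν.real (Icc 0 y)}

/-- The distribution function `x ↦ ν([0, x])` of a finite measure on `[0, ∞)`. -/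
def distFun (ν : Measure ℝ) (x : ℝ) : ℝ := ν.real (Icc 0 x)

/-- The uniform probability distribution on a set `s` of positive finite Lebesgue measure. -/
def unifOn (s : Set ℝ) : Measure ℝ := ProbabilityTheory.cond volume s

/-- The measure `ν_t`: the law of `(1 - t / V) * q_{ν₀}(V)`, where `V` is uniform on `[t, 1]`. -/
def radialFlow (ν₀ : Measure ℝ) (t : ℝ) : Measure ℝ :=
  (unifOn (Icc t 1)).map fun v => (1 - t / v) * quantile ν₀ v

/-- The measure `(1 - t) ν_t`. -/
def massFlow (ν₀ : Measure ℝ) (t : ℝ) : Measure ℝ :=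
  ENNReal.ofReal (1 - t) • radialFlow ν₀ t

/-- The rotationally invariant measure `ν ⊗ unif` on `ℂ`: the law of `ρ e^{iθ}`, where `ρ` has law
`ν`, `θ` is uniform on `[0, 2π)`, and `ρ`, `θ` are independent. -/
def rotInv (ν : Measure ℝ) : Measure ℂ :=
  (ν.prod (unifOn (Ico 0 (2 * Real.pi)))).map
    fun p : ℝ × ℝ => (p.1 : ℂ) * Complex.exp (p.2 * Complex.I)

/-- `Ψ_t(x)`, the distribution function of `(1 - t) ν_t`. -/
def Psi (ν₀ : Measure ℝ) (t x : ℝ) : ℝ := distFun (massFlow ν₀ t) x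

/-- `ψ(x, t)`, the derivative of `Ψ_t` at `x`. -/
def psi (ν₀ : Measure ℝ) (t x : ℝ) : ℝ := deriv (Psi ν₀ t) x

/-- The set of `(t, x)` with `t ∈ [0, 1)` and `x ∈ (0, A (1 - t))`. -/
def region (A : ℝ) : Set (ℝ × ℝ) := {p | p.1 ∈ Ico 0 1 ∧ p.2 ∈ Ioo 0 (A * (1 - p.1))}

/-- `ν` has density `g` with respect to the Lebesgue measure on the interval with endpoints
`0` and `A`. -/
def HasDensityOn (ν : Measure ℝ) (A : ℝ) (g : ℝ → ℝ) : Prop :=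
  ν = (volume.restrict (Ioo 0 A)).withDensity fun x => ENNReal.ofReal (g x)

instance (s : Set ℝ) : IsFiniteMeasure (unifOn s) := by
  unfold unifOn; infer_instance

instance (ν₀ : Measure ℝ) (t : ℝ) : IsFiniteMeasure (radialFlow ν₀ t) := by
  unfold radialFlow; infer_instance

instance (ν : Measure ℝ) [IsFiniteMeasure ν] : IsFiniteMeasure (rotInv ν) := by
  unfold rotInv; infer_instance

end RotDeriv

end

open RotDeriv

/-!
Write `F` for the distribution function of `ν₀`, `q` for its quantile function, and `k(v) = q(v) / v`.

**Radial flow.** Since `q` transports the uniform measure on `[0, 1]` to `ν₀` (`map_quantile`),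
`(1 - t) ν_t` is the image of Lebesgue measure on `[t, 1]` under the nondecreasing function
`v ↦ (1 - t / v) q(v)` (`massFlow_eq`). This function is lower semicontinuous from the left, so that
`s ↦ (1 - t / (s + t)) q(s + t) = s k(s + t)` is the quantile function of `(1 - t) ν_t`
(`le_Psi_iff`, `quantile_massFlow`). If `F` is a continuous increasing bijection, so is `Ψ_t`, as the
inverse of this function.

**Differential equations.** A continuous positive density makes `q` of class `C¹`, and
`J = k(s + t) + s k'(s + t)`, the derivative of the quantile function of `(1 - t) ν_t`, is positive.
The inverse function theorem for `(t, s) ↦ (t, s k(s + t))` shows that `Ψ` is `C¹`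
(`HasRegularQuantile.contDiffOn_Psi`). Differentiating `Ψ k(Ψ + t) = x` gives `∂ₓΨ = 1 / J` and
`∂ₜΨ = k / J - 1`, where `k = x / Ψ`. If the density is `C¹`, then `q` is `C²`, and both sides of the
equation for `ψ = 1 / J` are computed by one more differentiation
(`HasRegularQuantile.hasDerivWithinAt_psi`, `HasRegularQuantile.hasDerivAt_psi_div_mean`).

**Convergence of roots.** The `N`-th derivative of `p(z ^ m)` is `z ^ (-N) T(z ^ m)`, where the
coefficients of `T` are those of `p` multiplied by falling factorials (`fallingWeight`). If `p` has
the roots `r_j ^ m ≥ 0`, the coefficients of `T` are, up to binomial coefficients, those of a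
polynomial whose roots are the numbers `ρ_j = r_j ^ m * weightRatio m N j`. Bounds for the Mahler
measure then show that `∏ max R |w|`, over the roots `w` of `T`, equals `∏ max R ρ_j` up to a factor
`2 ^ n` (`prod_max_roots_bounds`). After taking `m`-th roots and logarithms this error is `O(n / m)`,
so that the ordered numbers `|w_j| ^ (1 / m)` have the same limits as
`ρ_j ^ (1 / m) ≈ r_j (1 - t n / j)`, which converge to `(1 - t / v)⁺ q(v)` for `j ≈ n v`
(`tendsto_weightRatio`, `tendsto_floor_of_continuousAt`). The `m`-th roots of each `w_j` are equally
spaced on a circle, which produces the uniform angle (`tendsto_average_circle`).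
-/

namespace RotDeriv

/-! ### Quantile functions -/

theorem distFun_mono (ν : Measure ℝ) [IsFiniteMeasure ν] : Monotone (distFun ν) :=
  fun _ _ h => measureReal_mono (Icc_subset_Icc_right h)

theorem quantile_nonneg (ν : Measure ℝ) (α : ℝ) : 0 ≤ quantile ν α :=
  Real.sInf_nonneg fun _ h => h.1

theorem quantile_le {ν : Measure ℝ} {α y : ℝ} (hy : 0 ≤ y) (h : α ≤ distFun ν y) :
    quantile ν α ≤ y :=
  csInf_le ⟨0, fun _ h => h.1⟩ ⟨hy, h⟩

/-- The infimum defining the quantile function is attained, because distribution functions are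
continuous from the right. -/
theorem le_distFun_quantile {ν : Measure ℝ} [IsFiniteMeasure ν] {α R : ℝ} (hR : 0 ≤ R)
    (h : α ≤ distFun ν R) : α ≤ distFun ν (quantile ν α) := by
  set q := quantile ν α with hq
  have hlim : Tendsto (fun r => ν (Icc 0 r)) (𝓝[>] q) (𝓝 (ν (⋂ r > q, Icc 0 r))) :=
    tendsto_measure_biInter_gt (fun r _ => measurableSet_Icc.nullMeasurableSet)
      (fun i j _ hij => Icc_subset_Icc_right hij) ⟨q + 1, by simp, measure_ne_top _ _⟩
  have hI : (⋂ r > q, Icc (0 : ℝ) r) = Icc 0 q := by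
    ext x
    simp only [mem_iInter, mem_Icc]
    refine ⟨fun hx => ⟨(hx (q + 1) (by simp)).1, le_of_forall_gt_imp_ge_of_dense fun r hr => (hx r hr).2⟩,
      fun hx r hr => ⟨hx.1, hx.2.trans (le_of_lt hr)⟩⟩
  rw [hI] at hlim
  have hlim' : Tendsto (fun r => distFun ν r) (𝓝[>] q) (𝓝 (distFun ν q)) :=
    (ENNReal.tendsto_toReal (measure_ne_top _ _)).comp hlim
  refine ge_of_tendsto hlim' ?_
  filter_upwards [self_mem_nhdsWithin] with r hr
  obtain ⟨y, hy, hyr⟩ := exists_lt_of_csInf_lt (s := {y : ℝ | 0 ≤ y ∧ α ≤ ν.real (Icc 0 y)})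
    ⟨R, hR, h⟩ (show sInf _ < r from hr)
  exact hy.2.trans (distFun_mono ν hyr.le)

theorem quantile_le_iff {ν : Measure ℝ} [IsFiniteMeasure ν] {α y R : ℝ} (hR : 0 ≤ R)
    (h : α ≤ distFun ν R) (hy : 0 ≤ y) : quantile ν α ≤ y ↔ α ≤ distFun ν y :=
  ⟨fun hq => (le_distFun_quantile hR h).trans (distFun_mono ν hq), quantile_le hy⟩

section Probability

variable {ν₀ : Measure ℝ} [IsProbabilityMeasure ν₀]

theorem exists_distFun_eq_one (hsupp : ∃ R : ℝ, ν₀ (Icc 0 R)ᶜ = 0) :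
    ∃ R : ℝ, 0 ≤ R ∧ distFun ν₀ R = 1 := by
  obtain ⟨R, hR⟩ := hsupp
  have h1 : ν₀ (Icc 0 R) = 1 := (prob_compl_eq_zero_iff measurableSet_Icc).1 hR
  refine ⟨R, ?_, by simp [distFun, measureReal_def, h1]⟩
  by_contra hneg
  rw [Icc_eq_empty hneg] at h1
  simp at h1

theorem measure_Iio_zero {ν : Measure ℝ} (hsupp : ∃ R : ℝ, ν (Icc 0 R)ᶜ = 0) :
    ν (Iio 0) = 0 := by
  obtain ⟨R, hR⟩ := hsupp
  have hsub : Iio (0 : ℝ) ⊆ (Icc 0 R)ᶜ := fun x hx h => absurd hx (not_lt.2 h.1)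
  exact measure_mono_null hsub hR

theorem distFun_le_one (x : ℝ) : distFun ν₀ x ≤ 1 := measureReal_le_one

theorem quantile_le_iff_of_le_one (hsupp : ∃ R : ℝ, ν₀ (Icc 0 R)ᶜ = 0) {α y : ℝ} (hα : α ≤ 1)
    (hy : 0 ≤ y) : quantile ν₀ α ≤ y ↔ α ≤ distFun ν₀ y := by
  obtain ⟨R, hR, h⟩ := exists_distFun_eq_one hsupp
  exact quantile_le_iff hR (h ▸ hα) hy

theorem quantile_monotoneOn (hsupp : ∃ R : ℝ, ν₀ (Icc 0 R)ᶜ = 0) :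
    MonotoneOn (quantile ν₀) (Iic 1) := fun _ ha _ hb hab =>
  (quantile_le_iff_of_le_one hsupp ha (quantile_nonneg _ _)).2
    (hab.trans ((quantile_le_iff_of_le_one hsupp hb (quantile_nonneg _ _)).1 le_rfl))

theorem quantile_zero (ν : Measure ℝ) : quantile ν 0 = 0 :=
  le_antisymm (quantile_le le_rfl measureReal_nonneg) (quantile_nonneg _ _)

theorem measure_Iic_eq {ν : Measure ℝ} (hsupp : ∃ R : ℝ, ν (Icc 0 R)ᶜ = 0) (y : ℝ) :
    ν (Iic y) = ν (Icc 0 y) := by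
  refine le_antisymm ?_ (measure_mono fun x hx => hx.2)
  calc ν (Iic y) ≤ ν (Iio 0 ∪ Icc 0 y) := measure_mono fun x hx => by
        rcases lt_or_ge x 0 with h | h
        · exact Or.inl h
        · exact Or.inr ⟨h, hx⟩
    _ ≤ ν (Iio 0) + ν (Icc 0 y) := measure_union_le _ _
    _ = ν (Icc 0 y) := by rw [measure_Iio_zero hsupp, zero_add]

/-- Inverse transform sampling: the quantile function of a uniform variable has law `ν₀`. -/
theorem map_quantile (hsupp : ∃ R : ℝ, ν₀ (Icc 0 R)ᶜ = 0) :
    (volume.restrict (Icc (0 : ℝ) 1)).map (quantile ν₀) = ν₀ := by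
  have hm : AEMeasurable (quantile ν₀) (volume.restrict (Icc (0 : ℝ) 1)) :=
    aemeasurable_restrict_of_monotoneOn measurableSet_Icc
      ((quantile_monotoneOn hsupp).mono fun x hx => hx.2)
  refine Measure.ext_of_Iic _ _ fun y => ?_
  rw [Measure.map_apply_of_aemeasurable hm measurableSet_Iic,
    Measure.restrict_apply' measurableSet_Icc, measure_Iic_eq hsupp]
  rcases lt_or_ge y 0 with hy | hy
  · have : quantile ν₀ ⁻¹' Iic y = ∅ := by
      ext v
      simpa using hy.trans_le (quantile_nonneg ν₀ v)
    simp [this, hy]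
  · have : quantile ν₀ ⁻¹' Iic y ∩ Icc 0 1 = Icc 0 (distFun ν₀ y) := by
      ext v
      simp only [mem_inter_iff, mem_preimage, mem_Iic, mem_Icc]
      constructor
      · rintro ⟨h, h0, h1⟩
        exact ⟨h0, (quantile_le_iff_of_le_one hsupp h1 hy).1 h⟩
      · rintro ⟨h0, h⟩
        have h1 := h.trans (distFun_le_one y)
        exact ⟨(quantile_le_iff_of_le_one hsupp h1 hy).2 h, h0, h1⟩
    rw [this, Real.volume_Icc, sub_zero, distFun, ofReal_measureReal]

/-! ### The flow of radial measures -/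

/-- The function `v ↦ (1 - t / v) q(v)`, where `q` is the quantile function of `ν₀`. On `[t, 1]` it
is the quantile function of `(1 - t) ν_t`, shifted by `t`. -/
noncomputable def flowRadius (ν₀ : Measure ℝ) (t v : ℝ) : ℝ := (1 - t / v) * quantile ν₀ v

theorem one_sub_div_nonneg {t v : ℝ} (ht : 0 ≤ t) (hv : t ≤ v) : 0 ≤ 1 - t / v :=
  sub_nonneg.2 (div_le_one_of_le₀ hv (ht.trans hv))

theorem flowRadius_nonneg {ν : Measure ℝ} {t v : ℝ} (ht : 0 ≤ t) (hv : t ≤ v) :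
    0 ≤ flowRadius ν t v :=
  mul_nonneg (one_sub_div_nonneg ht hv) (quantile_nonneg _ _)

theorem one_sub_div_mono {t u v : ℝ} (ht : 0 ≤ t) (hu : t ≤ u) (huv : u ≤ v) :
    1 - t / u ≤ 1 - t / v := by
  rcases ht.eq_or_lt with rfl | ht
  · simp
  · have := div_le_div_of_nonneg_left ht.le (ht.trans_le hu) huv
    linarith

theorem flowRadius_monotoneOn (hsupp : ∃ R : ℝ, ν₀ (Icc 0 R)ᶜ = 0) {t : ℝ} (ht : 0 ≤ t) :
    MonotoneOn (flowRadius ν₀ t) (Icc t 1) := fun _ hu _ hv huv =>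
  mul_le_mul (one_sub_div_mono ht hu.1 huv) (quantile_monotoneOn hsupp hu.2 hv.2 huv)
    (quantile_nonneg _ _) (one_sub_div_nonneg ht hv.1)

theorem aemeasurable_flowRadius (hsupp : ∃ R : ℝ, ν₀ (Icc 0 R)ᶜ = 0) {t : ℝ} (ht : 0 ≤ t) :
    AEMeasurable (flowRadius ν₀ t) (volume.restrict (Icc t 1)) :=
  aemeasurable_restrict_of_monotoneOn measurableSet_Icc (flowRadius_monotoneOn hsupp ht)

theorem radialFlow_eq (ν₀ : Measure ℝ) (t : ℝ) :
    radialFlow ν₀ t =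
      (ENNReal.ofReal (1 - t))⁻¹ • (volume.restrict (Icc t 1)).map (flowRadius ν₀ t) := by
  rw [radialFlow, unifOn, ProbabilityTheory.cond, Measure.map_smul, Real.volume_Icc]
  rfl

theorem massFlow_eq (ν₀ : Measure ℝ) {t : ℝ} (ht : t < 1) :
    massFlow ν₀ t = (volume.restrict (Icc t 1)).map (flowRadius ν₀ t) := by
  rw [massFlow, radialFlow_eq, smul_smul, ENNReal.mul_inv_cancel, one_smul]
  · simpa using ht
  · simp

instance (ν : Measure ℝ) (t : ℝ) : IsFiniteMeasure (massFlow ν t) := by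
  unfold massFlow
  exact Measure.smul_finite _ (by simp)

theorem massFlow_univ (hsupp : ∃ R : ℝ, ν₀ (Icc 0 R)ᶜ = 0) {t : ℝ} (ht : t ∈ Ico (0 : ℝ) 1) :
    massFlow ν₀ t univ = ENNReal.ofReal (1 - t) := by
  rw [massFlow_eq ν₀ ht.2, Measure.map_apply_of_aemeasurable (aemeasurable_flowRadius hsupp ht.1)
    MeasurableSet.univ]
  simp

theorem massFlow_zero (hsupp : ∃ R : ℝ, ν₀ (Icc 0 R)ᶜ = 0) : massFlow ν₀ 0 = ν₀ := by
  rw [massFlow_eq ν₀ one_pos]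
  convert map_quantile hsupp using 2
  ext v
  simp [flowRadius]

theorem massFlow_apply (hsupp : ∃ R : ℝ, ν₀ (Icc 0 R)ᶜ = 0) {t : ℝ} (ht : t ∈ Ico (0 : ℝ) 1)
    {s : Set ℝ} (hs : MeasurableSet s) :
    massFlow ν₀ t s = volume (flowRadius ν₀ t ⁻¹' s ∩ Icc t 1) := by
  rw [massFlow_eq ν₀ ht.2, Measure.map_apply_of_aemeasurable (aemeasurable_flowRadius hsupp ht.1)
    hs, Measure.restrict_apply' measurableSet_Icc]

theorem Psi_eq (hsupp : ∃ R : ℝ, ν₀ (Icc 0 R)ᶜ = 0) {t : ℝ} (ht : t ∈ Ico (0 : ℝ) 1) (x : ℝ) :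
    Psi ν₀ t x = volume.real (flowRadius ν₀ t ⁻¹' Icc 0 x ∩ Icc t 1) := by
  rw [Psi, distFun, measureReal_def, massFlow_apply hsupp ht measurableSet_Icc, measureReal_def]

theorem Psi_mono (ν : Measure ℝ) (t : ℝ) : Monotone (Psi ν t) := distFun_mono _

theorem Psi_nonneg (ν₀ : Measure ℝ) (t x : ℝ) : 0 ≤ Psi ν₀ t x := measureReal_nonneg

theorem Psi_le (hsupp : ∃ R : ℝ, ν₀ (Icc 0 R)ᶜ = 0) {t : ℝ} (ht : t ∈ Ico (0 : ℝ) 1) (x : ℝ) :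
    Psi ν₀ t x ≤ 1 - t := by
  have h : Psi ν₀ t x ≤ (massFlow ν₀ t).real univ := measureReal_mono (subset_univ _)
  rwa [measureReal_def, massFlow_univ hsupp ht, ENNReal.toReal_ofReal (by linarith [ht.2])] at h

/-- Left lower semicontinuity of `v ↦ (1 - t / v) q(v)`. -/
theorem exists_lt_flowRadius (hsupp : ∃ R : ℝ, ν₀ (Icc 0 R)ᶜ = 0) {t v x : ℝ} (ht : 0 ≤ t)
    (htv : t < v) (hv : v ≤ 1) (hx : 0 ≤ x) (h : x < flowRadius ν₀ t v) :
    ∃ u ∈ Ioo t v, x < flowRadius ν₀ t u := by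
  have hv0 : 0 < v := ht.trans_lt htv
  have hc : 0 < 1 - t / v := sub_pos.2 ((div_lt_one hv0).2 htv)
  have hxq : x / (1 - t / v) < quantile ν₀ v := by rwa [div_lt_iff₀' hc]
  obtain ⟨y, hxy, hyq⟩ := exists_between hxq
  have hy : 0 < y := (div_nonneg hx hc.le).trans_lt hxy
  have hFy : distFun ν₀ y < v := by
    rw [← not_le, ← quantile_le_iff_of_le_one hsupp hv hy.le, not_le]
    exact hyq
  have hcont : Tendsto (fun u : ℝ => (1 - t / u) * y) (𝓝[<] v) (𝓝 ((1 - t / v) * y)) := by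
    refine Tendsto.mono_left ?_ nhdsWithin_le_nhds
    exact ((tendsto_const_nhds.sub (tendsto_const_nhds.div tendsto_id hv0.ne')).mul
      tendsto_const_nhds)
  have hlt : x < (1 - t / v) * y := by rwa [div_lt_iff₀' hc] at hxy
  have h1 : ∀ᶠ u in 𝓝[<] v, u ∈ Ioo t v := Ioo_mem_nhdsLT htv
  have h2 : ∀ᶠ u in 𝓝[<] v, u ∈ Ioo (distFun ν₀ y) v := Ioo_mem_nhdsLT hFy
  obtain ⟨u, hu, hu1, hu2⟩ := ((hcont.eventually_const_lt hlt).and (h1.and h2)).exists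
  refine ⟨u, hu1, hu.trans_le ?_⟩
  refine mul_le_mul_of_nonneg_left (le_of_lt ?_) (one_sub_div_nonneg ht hu1.1.le)
  rw [← not_le, quantile_le_iff_of_le_one hsupp (hu1.2.le.trans hv) hy.le, not_le]
  exact hu2.1

/-- The Galois connection between `Ψ_t` and its quantile function `s ↦ (1 - t / (s + t)) q(s + t)`. -/
theorem le_Psi_iff (hsupp : ∃ R : ℝ, ν₀ (Icc 0 R)ᶜ = 0) {t s x : ℝ} (ht : t ∈ Ico (0 : ℝ) 1)
    (hs : s ∈ Ioc 0 (1 - t)) (hx : 0 ≤ x) :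
    s ≤ Psi ν₀ t x ↔ flowRadius ν₀ t (s + t) ≤ x := by
  rw [Psi_eq hsupp ht]
  have hst : s + t ∈ Icc t 1 := ⟨by linarith [hs.1], by linarith [hs.2]⟩
  constructor
  · intro h
    by_contra! hlt
    obtain ⟨u, hu, hxu⟩ := exists_lt_flowRadius hsupp ht.1 (by linarith [hs.1]) hst.2 hx hlt
    have hsub : flowRadius ν₀ t ⁻¹' Icc 0 x ∩ Icc t 1 ⊆ Icc t u := fun w hw =>
      ⟨hw.2.1, le_of_not_gt fun huw => absurd (hxu.trans_le
        (flowRadius_monotoneOn hsupp ht.1 ⟨hu.1.le, hu.2.le.trans hst.2⟩ hw.2 huw.le))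
        (not_lt.2 hw.1.2)⟩
    have h2 := h.trans (measureReal_mono hsub (by simp))
    rw [Real.volume_real_Icc_of_le hu.1.le] at h2
    linarith [hu.2]
  · intro h
    have hsub : Icc t (s + t) ⊆ flowRadius ν₀ t ⁻¹' Icc 0 x ∩ Icc t 1 := fun w hw =>
      have hw1 : w ∈ Icc t 1 := ⟨hw.1, hw.2.trans hst.2⟩
      ⟨⟨flowRadius_nonneg ht.1 hw.1, (flowRadius_monotoneOn hsupp ht.1 hw1 hst hw.2).trans h⟩, hw1⟩
    have h2 := measureReal_mono (μ := volume) hsub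
      (measure_ne_top_of_subset inter_subset_right (by simp))
    rw [Real.volume_real_Icc_of_le (by linarith [hs.1])] at h2
    linarith

theorem flowRadius_add (ν₀ : Measure ℝ) {t s : ℝ} (h : s + t ≠ 0) :
    flowRadius ν₀ t (s + t) = s * quantile ν₀ (s + t) / (s + t) := by
  rw [flowRadius]
  field_simp
  ring

theorem flowRadius_self (ν₀ : Measure ℝ) (t : ℝ) : flowRadius ν₀ t t = 0 := by
  rcases eq_or_ne t 0 with rfl | h
  · simp [flowRadius, quantile_zero]
  · simp [flowRadius, h]

theorem quantile_massFlow (hsupp : ∃ R : ℝ, ν₀ (Icc 0 R)ᶜ = 0) {t s : ℝ} (ht : t ∈ Ico (0 : ℝ) 1)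
    (hs : s ∈ Icc 0 (1 - t)) : quantile (massFlow ν₀ t) s = flowRadius ν₀ t (s + t) := by
  rcases hs.1.eq_or_lt with rfl | h0
  · rw [quantile_zero, zero_add, flowRadius_self]
  · have hset : {y : ℝ | 0 ≤ y ∧ s ≤ (massFlow ν₀ t).real (Icc 0 y)} =
        Ici (flowRadius ν₀ t (s + t)) := by
      ext y
      constructor
      · rintro ⟨hy, h⟩
        exact (le_Psi_iff hsupp ht ⟨h0, hs.2⟩ hy).1 h
      · intro h
        have hy : 0 ≤ y := (flowRadius_nonneg ht.1 (by linarith)).trans h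
        exact ⟨hy, (le_Psi_iff hsupp ht ⟨h0, hs.2⟩ hy).2 h⟩
    rw [quantile, hset, csInf_Ici]

/-! ### Continuous strictly increasing distribution functions -/

theorem _root_.MonotoneOn.continuousOn_of_surjOn_Icc {f : ℝ → ℝ} {a b c d : ℝ}
    (hf : MonotoneOn f (Icc a b)) (hm : MapsTo f (Icc a b) (Icc c d))
    (hs : SurjOn f (Icc a b) (Icc c d)) : ContinuousOn f (Icc a b) := by
  intro x hx
  refine tendsto_order.2 ⟨fun y hy => ?_, fun y hy => ?_⟩
  · by_cases hcy : y < c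
    · filter_upwards [self_mem_nhdsWithin] with z hz using hcy.trans_le (hm hz).1
    · obtain ⟨w, hyw, hwx⟩ := exists_between hy
      obtain ⟨z, hz, rfl⟩ := hs ⟨(not_lt.1 hcy).trans hyw.le, hwx.le.trans (hm hx).2⟩
      have hzx : z < x := lt_of_not_ge fun h => absurd (hf hx hz h) (not_le.2 hwx)
      filter_upwards [self_mem_nhdsWithin, mem_nhdsWithin_of_mem_nhds (Ioi_mem_nhds hzx)]
        with u hu hzu using hyw.trans_le (hf hz hu (le_of_lt hzu))
  · by_cases hcy : d < y
    · filter_upwards [self_mem_nhdsWithin] with z hz using (hm hz).2.trans_lt hcy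
    · obtain ⟨w, hyw, hwx⟩ := exists_between hy
      obtain ⟨z, hz, rfl⟩ := hs ⟨(hm hx).1.trans hyw.le, hwx.le.trans (not_lt.1 hcy)⟩
      have hzx : x < z := lt_of_not_ge fun h => absurd (hf hz hx h) (not_le.2 hyw)
      filter_upwards [self_mem_nhdsWithin, mem_nhdsWithin_of_mem_nhds (Iio_mem_nhds hzx)]
        with u hu hzu using (hf hu hz (le_of_lt hzu)).trans_lt hwx

section StrictlyIncreasing

variable {A : ℝ}

theorem invOn_quantile {ν : Measure ℝ} (hF : StrictMonoOn (distFun ν) (Icc 0 A))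
    (hb : BijOn (distFun ν) (Icc 0 A) (Icc 0 1)) :
    InvOn (quantile ν) (distFun ν) (Icc 0 A) (Icc 0 1) := by
  have hl : LeftInvOn (quantile ν) (distFun ν) (Icc 0 A) := by
    intro x hx
    refine le_antisymm (quantile_le hx.1 le_rfl) (le_csInf ⟨x, hx.1, le_rfl⟩ ?_)
    rintro y ⟨hy0, hy⟩
    by_contra! hyx
    exact absurd (hF ⟨hy0, hyx.le.trans hx.2⟩ hx hyx) (not_lt.2 hy)
  exact ⟨hl, hl.rightInvOn_image.mono (hb.image_eq ▸ Subset.rfl)⟩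

theorem bijOn_quantile {ν : Measure ℝ} (hF : StrictMonoOn (distFun ν) (Icc 0 A))
    (hb : BijOn (distFun ν) (Icc 0 A) (Icc 0 1)) :
    BijOn (quantile ν) (Icc 0 1) (Icc 0 A) :=
  hb.symm (invOn_quantile hF hb).symm

theorem strictMonoOn_quantile {ν : Measure ℝ} (hF : StrictMonoOn (distFun ν) (Icc 0 A))
    (hb : BijOn (distFun ν) (Icc 0 A) (Icc 0 1)) :
    StrictMonoOn (quantile ν) (Icc 0 1) := by
  intro u hu v hv huv
  have hq := bijOn_quantile hF hb
  rw [← hF.lt_iff_lt (hq.mapsTo hu) (hq.mapsTo hv), (invOn_quantile hF hb).2 hu,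
    (invOn_quantile hF hb).2 hv]
  exact huv

theorem continuousOn_quantile {ν : Measure ℝ} (hF : StrictMonoOn (distFun ν) (Icc 0 A))
    (hb : BijOn (distFun ν) (Icc 0 A) (Icc 0 1)) :
    ContinuousOn (quantile ν) (Icc 0 1) :=
  (strictMonoOn_quantile hF hb).monotoneOn.continuousOn_of_surjOn_Icc
    (bijOn_quantile hF hb).mapsTo (bijOn_quantile hF hb).surjOn

theorem quantile_one {ν : Measure ℝ} (hA : 0 < A) (hF : StrictMonoOn (distFun ν) (Icc 0 A))
    (hb : BijOn (distFun ν) (Icc 0 A) (Icc 0 1)) : quantile ν 1 = A := by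
  have hq := bijOn_quantile hF hb
  obtain ⟨v, hv, hvA⟩ := hq.surjOn (right_mem_Icc.2 hA.le)
  refine le_antisymm (hq.mapsTo (right_mem_Icc.2 zero_le_one)).2 ?_
  rw [← hvA]
  exact (strictMonoOn_quantile hF hb).monotoneOn hv (right_mem_Icc.2 zero_le_one) hv.2

theorem strictMonoOn_flowRadius {ν : Measure ℝ} (hF : StrictMonoOn (distFun ν) (Icc 0 A))
    (hb : BijOn (distFun ν) (Icc 0 A) (Icc 0 1)) {t : ℝ} (ht : 0 ≤ t) :
    StrictMonoOn (flowRadius ν t) (Icc t 1) := by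
  intro u hu v hv huv
  have hq := strictMonoOn_quantile hF hb ⟨ht.trans hu.1, hu.2⟩ ⟨ht.trans hv.1, hv.2⟩ huv
  have hc : 0 < 1 - t / v :=
    sub_pos.2 ((div_lt_one (ht.trans_lt (hu.1.trans_lt huv))).2 (hu.1.trans_lt huv))
  exact (mul_le_mul_of_nonneg_right (one_sub_div_mono ht hu.1 huv.le)
    (quantile_nonneg _ _)).trans_lt (mul_lt_mul_of_pos_left hq hc)

theorem continuousOn_flowRadius {ν : Measure ℝ} (hF : StrictMonoOn (distFun ν) (Icc 0 A))
    (hb : BijOn (distFun ν) (Icc 0 A) (Icc 0 1)) {t : ℝ} (ht : 0 ≤ t) :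
    ContinuousOn (flowRadius ν t) (Icc t 1) := by
  have hq : ContinuousOn (quantile ν) (Icc t 1) :=
    (continuousOn_quantile hF hb).mono (Icc_subset_Icc_left ht)
  rcases ht.eq_or_lt with rfl | h0
  · refine hq.congr fun v _ => ?_
    simp [flowRadius]
  · exact (continuousOn_const.sub (continuousOn_const.div continuousOn_id
      fun v hv => (h0.trans_le hv.1).ne')).mul hq

theorem bijOn_flowRadius {ν : Measure ℝ} (hA : 0 < A) (hF : StrictMonoOn (distFun ν) (Icc 0 A))
    (hb : BijOn (distFun ν) (Icc 0 A) (Icc 0 1)) {t : ℝ} (ht : t ∈ Ico (0 : ℝ) 1) :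
    BijOn (fun s => flowRadius ν t (s + t)) (Icc 0 (1 - t)) (Icc 0 (A * (1 - t))) := by
  have hm : MapsTo (fun s => s + t) (Icc 0 (1 - t)) (Icc t 1) := fun s hs =>
    ⟨by linarith [hs.1], by linarith [hs.2]⟩
  have h1 : flowRadius ν t 1 = A * (1 - t) := by
    rw [flowRadius, quantile_one hA hF hb, div_one, mul_comm]
  have hmono := (strictMonoOn_flowRadius hF hb ht.1).monotoneOn
  refine ⟨fun s hs => ⟨?_, ?_⟩, fun s hs s' hs' h => ?_, ?_⟩
  · exact flowRadius_nonneg ht.1 (hm hs).1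
  · rw [← h1]
    exact hmono (hm hs) (right_mem_Icc.2 ht.2.le) (hm hs).2
  · exact add_right_cancel ((strictMonoOn_flowRadius hF hb ht.1).injOn (hm hs) (hm hs') h)
  · intro x hx
    have := intermediate_value_Icc ht.2.le (continuousOn_flowRadius hF hb ht.1)
    rw [flowRadius_self, h1] at this
    obtain ⟨v, hv, hvx⟩ := this hx
    exact ⟨v - t, ⟨by linarith [hv.1], by linarith [hv.2]⟩, by simpa using hvx⟩

theorem Psi_flowRadius (hsupp : ∃ R : ℝ, ν₀ (Icc 0 R)ᶜ = 0)
    (hF : StrictMonoOn (distFun ν₀) (Icc 0 A))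
    (hb : BijOn (distFun ν₀) (Icc 0 A) (Icc 0 1)) {t s : ℝ} (ht : t ∈ Ico (0 : ℝ) 1)
    (hs : s ∈ Icc 0 (1 - t)) : Psi ν₀ t (flowRadius ν₀ t (s + t)) = s := by
  have hnn : 0 ≤ flowRadius ν₀ t (s + t) := flowRadius_nonneg ht.1 (by linarith [hs.1])
  apply le_antisymm
  · by_contra! hlt
    have hle := Psi_le hsupp ht (flowRadius ν₀ t (s + t))
    have h := (le_Psi_iff hsupp ht ⟨hs.1.trans_lt hlt, hle⟩ hnn).1 le_rfl
    refine absurd (strictMonoOn_flowRadius hF hb ht.1 (a := s + t) ?_ ?_ ?_) (not_lt.2 h)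
    · exact ⟨by linarith [hs.1], by linarith [hs.2]⟩
    · exact ⟨by linarith [hs.1], by linarith⟩
    · linarith
  · rcases hs.1.eq_or_lt with rfl | h0
    · exact Psi_nonneg _ _ _
    · exact (le_Psi_iff hsupp ht ⟨h0, hs.2⟩ hnn).2 le_rfl

theorem invOn_flowRadius_Psi (hsupp : ∃ R : ℝ, ν₀ (Icc 0 R)ᶜ = 0) (hA : 0 < A)
    (hF : StrictMonoOn (distFun ν₀) (Icc 0 A))
    (hb : BijOn (distFun ν₀) (Icc 0 A) (Icc 0 1)) {t : ℝ} (ht : t ∈ Ico (0 : ℝ) 1) :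
    InvOn (fun s => flowRadius ν₀ t (s + t)) (Psi ν₀ t) (Icc 0 (A * (1 - t))) (Icc 0 (1 - t)) := by
  have hr : RightInvOn (fun s => flowRadius ν₀ t (s + t)) (Psi ν₀ t) (Icc 0 (1 - t)) :=
    fun s hs => Psi_flowRadius hsupp hF hb ht hs
  refine ⟨?_, hr⟩
  have h2 := LeftInvOn.rightInvOn_image hr
  rwa [(bijOn_flowRadius hA hF hb ht).image_eq] at h2

theorem bijOn_Psi (hsupp : ∃ R : ℝ, ν₀ (Icc 0 R)ᶜ = 0) (hA : 0 < A)
    (hF : StrictMonoOn (distFun ν₀) (Icc 0 A))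
    (hb : BijOn (distFun ν₀) (Icc 0 A) (Icc 0 1)) {t : ℝ} (ht : t ∈ Ico (0 : ℝ) 1) :
    BijOn (Psi ν₀ t) (Icc 0 (A * (1 - t))) (Icc 0 (1 - t)) :=
  (bijOn_flowRadius hA hF hb ht).symm (invOn_flowRadius_Psi hsupp hA hF hb ht)

theorem strictMonoOn_Psi (hsupp : ∃ R : ℝ, ν₀ (Icc 0 R)ᶜ = 0) (hA : 0 < A)
    (hF : StrictMonoOn (distFun ν₀) (Icc 0 A))
    (hb : BijOn (distFun ν₀) (Icc 0 A) (Icc 0 1)) {t : ℝ} (ht : t ∈ Ico (0 : ℝ) 1) :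
    StrictMonoOn (Psi ν₀ t) (Icc 0 (A * (1 - t))) := fun _ hx _ hy hxy =>
  (Psi_mono ν₀ t hxy.le).lt_of_ne fun h =>
    hxy.ne ((bijOn_Psi hsupp hA hF hb ht).injOn hx hy h)

theorem continuousOn_Psi (hsupp : ∃ R : ℝ, ν₀ (Icc 0 R)ᶜ = 0) (hA : 0 < A)
    (hF : StrictMonoOn (distFun ν₀) (Icc 0 A))
    (hb : BijOn (distFun ν₀) (Icc 0 A) (Icc 0 1)) {t : ℝ} (ht : t ∈ Ico (0 : ℝ) 1) :
    ContinuousOn (Psi ν₀ t) (Icc 0 (A * (1 - t))) :=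
  ((Psi_mono ν₀ t).monotoneOn _).continuousOn_of_surjOn_Icc
    (bijOn_Psi hsupp hA hF hb ht).mapsTo (bijOn_Psi hsupp hA hF hb ht).surjOn

theorem invOn_quantile_massFlow (hsupp : ∃ R : ℝ, ν₀ (Icc 0 R)ᶜ = 0) (hA : 0 < A)
    (hF : StrictMonoOn (distFun ν₀) (Icc 0 A))
    (hb : BijOn (distFun ν₀) (Icc 0 A) (Icc 0 1)) {t : ℝ} (ht : t ∈ Ico (0 : ℝ) 1) :
    InvOn (quantile (massFlow ν₀ t)) (Psi ν₀ t) (Icc 0 (A * (1 - t))) (Icc 0 (1 - t)) := by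
  have h := invOn_flowRadius_Psi hsupp hA hF hb ht
  refine ⟨fun x hx => ?_, fun s hs => ?_⟩
  · rw [quantile_massFlow hsupp ht ((bijOn_Psi hsupp hA hF hb ht).mapsTo hx)]
    exact h.1 hx
  · rw [quantile_massFlow hsupp ht hs]
    exact h.2 hs

theorem invFunOn_Psi_div (hsupp : ∃ R : ℝ, ν₀ (Icc 0 R)ᶜ = 0) (hA : 0 < A)
    (hF : StrictMonoOn (distFun ν₀) (Icc 0 A))
    (hb : BijOn (distFun ν₀) (Icc 0 A) (Icc 0 1)) {t x : ℝ} (ht : t ∈ Ico (0 : ℝ) 1)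
    (hx : x ∈ Ioo 0 (1 - t)) :
    Function.invFunOn (Psi ν₀ t) (Icc 0 (A * (1 - t))) x / x =
      Function.invFunOn (distFun ν₀) (Icc 0 A) (x + t) / (x + t) := by
  have hxt : x + t ∈ Icc (0 : ℝ) 1 := ⟨by linarith [hx.1, ht.1], by linarith [hx.2]⟩
  have hB := bijOn_Psi hsupp hA hF hb ht
  have hx' : x ∈ Icc 0 (1 - t) := Ioo_subset_Icc_self hx
  have e1 : Function.invFunOn (Psi ν₀ t) (Icc 0 (A * (1 - t))) x = flowRadius ν₀ t (x + t) := by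
    refine hB.injOn (Function.invFunOn_mem (hB.surjOn hx'))
      ((bijOn_flowRadius hA hF hb ht).mapsTo hx') ?_
    rw [Function.invFunOn_eq (hB.surjOn hx'), Psi_flowRadius hsupp hF hb ht hx']
  have e2 : Function.invFunOn (distFun ν₀) (Icc 0 A) (x + t) = quantile ν₀ (x + t) := by
    refine hb.injOn (Function.invFunOn_mem (hb.surjOn hxt))
      ((bijOn_quantile hF hb).mapsTo hxt) ?_
    rw [Function.invFunOn_eq (hb.surjOn hxt), (invOn_quantile hF hb).2 hxt]
  have hne : x + t ≠ 0 := by linarith [hx.1, ht.1]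
  rw [e1, e2, flowRadius_add ν₀ hne]
  have := hx.1.ne'
  field_simp

end StrictlyIncreasing

end Probability

/-! ### Measures with a positive density -/

section Density

variable {μ : Measure ℝ} {B : ℝ} {g : ℝ → ℝ}

theorem Iic_inter_Ioo_ae_eq (y B : ℝ) :
    (Iic y ∩ Ioo 0 B : Set ℝ) =ᵐ[volume] Ioc 0 (min B y) := by
  rw [← Ioc_inter_Iic, inter_comm]
  exact (Ioo_ae_eq_Ioc (μ := volume)).inter (ae_eq_refl _)

theorem lintegral_Iic_inter_Ioo (hg : IntegrableOn g (Ioo 0 B)) (h0 : ∀ x ∈ Ioo 0 B, 0 ≤ g x)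
    (hB : 0 ≤ B) {y : ℝ} (hy : 0 ≤ y) :
    ∫⁻ x in Iic y ∩ Ioo 0 B, ENNReal.ofReal (g x) =
      ENNReal.ofReal (∫ x in (0 : ℝ)..(min B y), g x) := by
  rw [intervalIntegral.integral_of_le (le_min hB hy),
    ← setIntegral_congr_set (Iic_inter_Ioo_ae_eq y B), ofReal_integral_eq_lintegral_ofReal]
  · exact hg.mono_set inter_subset_right
  · exact (ae_restrict_iff' (measurableSet_Iic.inter measurableSet_Ioo)).2
      (Eventually.of_forall fun x hx => h0 x hx.2)

/-- A finite measure on `[0, B]` whose distribution function is continuous, with a positive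
derivative on `(0, B)`, has that derivative as density. -/
theorem hasDensityOn_of_hasDerivAt [IsFiniteMeasure μ] (hB : 0 ≤ B) (hμ : μ (Icc 0 B)ᶜ = 0)
    (hc : ContinuousOn (distFun μ) (Icc 0 B)) (h0 : distFun μ 0 = 0)
    (hd : ∀ x ∈ Ioo 0 B, HasDerivAt (distFun μ) (g x) x) (hg : ∀ x ∈ Ioo 0 B, 0 ≤ g x) :
    HasDensityOn μ B g := by
  have hint : IntegrableOn g (Ioc 0 B) :=
    intervalIntegral.integrableOn_deriv_of_nonneg hc hd hg
  have hint' : IntegrableOn g (Ioo 0 B) := hint.mono_set Ioo_subset_Ioc_self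
  refine Measure.ext_of_Iic _ _ fun y => ?_
  rw [withDensity_apply _ measurableSet_Iic, Measure.restrict_restrict measurableSet_Iic]
  rcases lt_or_ge y 0 with hy | hy
  · have h1 : Iic y ∩ Ioo 0 B = ∅ := by
      ext x
      simp only [mem_inter_iff, mem_Iic, mem_Ioo, mem_empty_iff_false, iff_false]
      rintro ⟨h, h', -⟩
      linarith
    rw [h1, measure_Iic_eq ⟨B, hμ⟩, Icc_eq_empty (not_le.2 hy)]
    simp
  · have hm : 0 ≤ min B y := le_min hB hy
    have hsub : Icc 0 (min B y) ⊆ Icc 0 B := Icc_subset_Icc_right (min_le_left _ _)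
    rw [lintegral_Iic_inter_Ioo hint' hg hB hy,
      intervalIntegral.integral_eq_sub_of_hasDerivAt_of_le hm (hc.mono hsub)
        (fun x hx => hd x ⟨hx.1, hx.2.trans_le (min_le_left _ _)⟩), h0, sub_zero, distFun,
      ofReal_measureReal]
    · refine le_antisymm ?_ (measure_mono fun x hx => hx.2.trans (min_le_right _ _))
      calc μ (Iic y) ≤ μ (Icc 0 (min B y) ∪ (Icc 0 B)ᶜ) := measure_mono fun x hx => by
            by_cases h : x ∈ Icc 0 B
            · exact Or.inl ⟨h.1, le_min h.2 hx⟩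
            · exact Or.inr h
        _ ≤ μ (Icc 0 (min B y)) + μ (Icc 0 B)ᶜ := measure_union_le _ _
        _ = μ (Icc 0 (min B y)) := by rw [hμ, add_zero]
    · exact (intervalIntegrable_iff_integrableOn_Ioc_of_le hm).2
        (hint.mono_set (Ioc_subset_Ioc_right (min_le_left _ _)))

theorem HasDensityOn.measure_compl_Icc (h : HasDensityOn μ B g) : μ (Icc 0 B)ᶜ = 0 := by
  rw [h, withDensity_apply _ measurableSet_Icc.compl,
    Measure.restrict_restrict measurableSet_Icc.compl,
    (disjoint_compl_left.mono_right Ioo_subset_Icc_self).inter_eq, Measure.restrict_empty,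
    lintegral_zero_measure]

theorem HasDensityOn.integrableOn [IsFiniteMeasure μ] (h : HasDensityOn μ B g)
    (hc : ContinuousOn g (Ioo 0 B)) (hg : ∀ x ∈ Ioo 0 B, 0 < g x) : IntegrableOn g (Ioo 0 B) := by
  refine ⟨hc.aestronglyMeasurable measurableSet_Ioo, ?_⟩
  rw [hasFiniteIntegral_iff_ofReal]
  · have h1 : μ univ < ⊤ := measure_lt_top _ _
    rw [h] at h1
    rwa [withDensity_apply _ MeasurableSet.univ, Measure.restrict_univ] at h1
  · exact (ae_restrict_iff' measurableSet_Ioo).2 (Eventually.of_forall fun x hx => (hg x hx).le)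

theorem HasDensityOn.distFun_eq [IsFiniteMeasure μ] (h : HasDensityOn μ B g)
    (hc : ContinuousOn g (Ioo 0 B)) (hg : ∀ x ∈ Ioo 0 B, 0 < g x) {x : ℝ} (hx : x ∈ Icc 0 B) :
    distFun μ x = ∫ u in (0 : ℝ)..x, g u := by
  have hB : 0 ≤ B := hx.1.trans hx.2
  have hμ : ∃ R : ℝ, μ (Icc 0 R)ᶜ = 0 := ⟨B, h.measure_compl_Icc⟩
  have h2 : μ (Icc 0 x) = ENNReal.ofReal (∫ u in (0 : ℝ)..x, g u) := by
    conv_lhs => rw [← measure_Iic_eq hμ, h, withDensity_apply _ measurableSet_Iic,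
      Measure.restrict_restrict measurableSet_Iic]
    rw [lintegral_Iic_inter_Ioo (h.integrableOn hc hg) (fun x hx => (hg x hx).le) hB hx.1,
      min_eq_right hx.2]
  rw [distFun, measureReal_def, h2, ENNReal.toReal_ofReal]
  rw [intervalIntegral.integral_of_le hx.1, integral_Ioc_eq_integral_Ioo]
  exact setIntegral_nonneg measurableSet_Ioo fun u hu => (hg u ⟨hu.1, hu.2.trans_le hx.2⟩).le

theorem HasDensityOn.intervalIntegrable [IsFiniteMeasure μ] (h : HasDensityOn μ B g)
    (hc : ContinuousOn g (Ioo 0 B)) (hg : ∀ x ∈ Ioo 0 B, 0 < g x) (hB : 0 ≤ B) :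
    IntervalIntegrable g volume 0 B := by
  rw [intervalIntegrable_iff_integrableOn_Ioc_of_le hB, integrableOn_Ioc_iff_integrableOn_Ioo]
  exact h.integrableOn hc hg

theorem HasDensityOn.continuousOn_distFun [IsFiniteMeasure μ] (h : HasDensityOn μ B g)
    (hc : ContinuousOn g (Ioo 0 B)) (hg : ∀ x ∈ Ioo 0 B, 0 < g x) (hB : 0 ≤ B) :
    ContinuousOn (distFun μ) (Icc 0 B) := by
  have h1 := intervalIntegral.continuousOn_primitive_interval'
    (h.intervalIntegrable hc hg hB) left_mem_uIcc
  rw [uIcc_of_le hB] at h1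
  exact h1.congr fun x hx => h.distFun_eq hc hg hx

theorem HasDensityOn.hasDerivAt_distFun [IsFiniteMeasure μ] (h : HasDensityOn μ B g)
    (hc : ContinuousOn g (Ioo 0 B)) (hg : ∀ x ∈ Ioo 0 B, 0 < g x) {x : ℝ} (hx : x ∈ Ioo 0 B) :
    HasDerivAt (distFun μ) (g x) x := by
  have hB : 0 ≤ B := hx.1.le.trans hx.2.le
  have hnhds : Ioo 0 B ∈ 𝓝 x := Ioo_mem_nhds hx.1 hx.2
  have h1 : HasDerivAt (fun y => ∫ u in (0 : ℝ)..y, g u) (g x) x := by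
    refine intervalIntegral.integral_hasDerivAt_right ?_
      (hc.stronglyMeasurableAtFilter isOpen_Ioo x hx) (hc.continuousAt hnhds)
    exact (h.intervalIntegrable hc hg hB).mono_set
      (uIcc_subset_uIcc_left (by rw [uIcc_of_le hB]; exact Ioo_subset_Icc_self hx))
  refine h1.congr_of_eventuallyEq ?_
  filter_upwards [hnhds] with y hy using h.distFun_eq hc hg (Ioo_subset_Icc_self hy)

theorem HasDensityOn.strictMonoOn_distFun [IsFiniteMeasure μ] (h : HasDensityOn μ B g)
    (hc : ContinuousOn g (Ioo 0 B)) (hg : ∀ x ∈ Ioo 0 B, 0 < g x) (hB : 0 ≤ B) :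
    StrictMonoOn (distFun μ) (Icc 0 B) := by
  refine strictMonoOn_of_deriv_pos (convex_Icc 0 B) (h.continuousOn_distFun hc hg hB) ?_
  intro x hx
  rw [interior_Icc] at hx
  rw [(h.hasDerivAt_distFun hc hg hx).deriv]
  exact hg x hx

theorem HasDensityOn.bijOn_distFun [IsProbabilityMeasure μ] (h : HasDensityOn μ B g)
    (hc : ContinuousOn g (Ioo 0 B)) (hg : ∀ x ∈ Ioo 0 B, 0 < g x) (hB : 0 ≤ B) :
    BijOn (distFun μ) (Icc 0 B) (Icc 0 1) := by
  have h0 : distFun μ 0 = 0 := by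
    rw [h.distFun_eq hc hg (left_mem_Icc.2 hB), intervalIntegral.integral_same]
  have h1 : distFun μ B = 1 := by
    rw [distFun, measureReal_def,
      (prob_compl_eq_zero_iff measurableSet_Icc).1 h.measure_compl_Icc,
      ENNReal.toReal_one]
  refine ⟨fun x _ => ⟨measureReal_nonneg, distFun_le_one x⟩,
    (h.strictMonoOn_distFun hc hg hB).injOn, ?_⟩
  have h2 := intermediate_value_Icc hB (h.continuousOn_distFun hc hg hB)
  rwa [h0, h1] at h2

end Density

/-! ### Smooth quantile functions -/

/-- The distribution function of `ν` is a strictly increasing bijection from `[0, A]` to `[0, 1]`,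
whose inverse, the quantile function, is `C¹` with positive derivative on `(0, 1)`. -/
structure HasRegularQuantile (ν : Measure ℝ) (A : ℝ) : Prop where
  pos : 0 < A
  strictMonoOn : StrictMonoOn (distFun ν) (Icc 0 A)
  bijOn : BijOn (distFun ν) (Icc 0 A) (Icc 0 1)
  contDiffOn : ContDiffOn ℝ 1 (quantile ν) (Ioo 0 1)
  deriv_pos : ∀ v ∈ Ioo (0 : ℝ) 1, 0 < deriv (quantile ν) v

theorem quantile_mem_Ioo {ν : Measure ℝ} {A : ℝ} (hA : 0 < A) (hF : StrictMonoOn (distFun ν) (Icc 0 A))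
    (hb : BijOn (distFun ν) (Icc 0 A) (Icc 0 1)) {v : ℝ} (hv : v ∈ Ioo (0 : ℝ) 1) :
    quantile ν v ∈ Ioo 0 A := by
  have hs := strictMonoOn_quantile hF hb
  have hv' := Ioo_subset_Icc_self hv
  constructor
  · rw [← quantile_zero ν]
    exact hs (left_mem_Icc.2 zero_le_one) hv' hv.1
  · rw [← quantile_one hA hF hb]
    exact hs hv' (right_mem_Icc.2 zero_le_one) hv.2

section OfDensity

variable {ν₀ : Measure ℝ} [IsProbabilityMeasure ν₀] {A : ℝ} {ψ₀ : ℝ → ℝ}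

theorem HasDensityOn.hasDerivAt_quantile (h : HasDensityOn ν₀ A ψ₀) (hA : 0 < A)
    (hc : ContinuousOn ψ₀ (Ioo 0 A)) (hg : ∀ x ∈ Ioo 0 A, 0 < ψ₀ x) {v : ℝ}
    (hv : v ∈ Ioo (0 : ℝ) 1) :
    HasDerivAt (quantile ν₀) (ψ₀ (quantile ν₀ v))⁻¹ v := by
  have hF := h.strictMonoOn_distFun hc hg hA.le
  have hb := h.bijOn_distFun hc hg hA.le
  have hq := quantile_mem_Ioo hA hF hb hv
  have hnhds : Icc 0 1 ∈ 𝓝 v := Icc_mem_nhds hv.1 hv.2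
  refine HasDerivAt.of_local_left_inverse ((continuousOn_quantile hF hb).continuousAt hnhds)
    (h.hasDerivAt_distFun hc hg hq) (hg _ hq).ne' ?_
  filter_upwards [hnhds] with u hu using (invOn_quantile hF hb).2 hu

/-- A density of class `Cⁿ` makes the quantile function of class `Cⁿ⁺¹`. -/
theorem HasDensityOn.contDiffOn_quantile (h : HasDensityOn ν₀ A ψ₀) (hA : 0 < A)
    (hg : ∀ x ∈ Ioo 0 A, 0 < ψ₀ x) (n : ℕ) (hc : ContDiffOn ℝ n ψ₀ (Ioo 0 A)) :
    ContDiffOn ℝ (n + 1) (quantile ν₀) (Ioo 0 1) := by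
  induction n with
  | zero =>
    have hd := fun v hv => h.hasDerivAt_quantile hA hc.continuousOn hg (v := v) hv
    have hF := h.strictMonoOn_distFun hc.continuousOn hg hA.le
    have hb := h.bijOn_distFun hc.continuousOn hg hA.le
    rw [contDiffOn_succ_iff_deriv_of_isOpen isOpen_Ioo]
    refine ⟨fun v hv => (hd v hv).differentiableAt.differentiableWithinAt, by simp, ?_⟩
    refine ContDiffOn.congr (f := fun v => (ψ₀ (quantile ν₀ v))⁻¹) ?_ fun v hv => (hd v hv).deriv
    refine ContDiffOn.inv ?_ fun v hv => (hg _ (quantile_mem_Ioo hA hF hb hv)).ne'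
    refine contDiffOn_zero.2 (hc.continuousOn.comp
      ((continuousOn_quantile hF hb).mono Ioo_subset_Icc_self) fun v hv => ?_)
    exact quantile_mem_Ioo hA hF hb hv
  | succ n ih =>
    have hd := fun v hv => h.hasDerivAt_quantile hA hc.continuousOn hg (v := v) hv
    have hF := h.strictMonoOn_distFun hc.continuousOn hg hA.le
    have hb := h.bijOn_distFun hc.continuousOn hg hA.le
    have hq := ih (hc.of_le (by exact_mod_cast Nat.le_succ n))
    rw [contDiffOn_succ_iff_deriv_of_isOpen isOpen_Ioo]
    refine ⟨fun v hv => (hd v hv).differentiableAt.differentiableWithinAt, by simp, ?_⟩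
    refine ContDiffOn.congr (f := fun v => (ψ₀ (quantile ν₀ v))⁻¹) ?_ fun v hv => (hd v hv).deriv
    refine ContDiffOn.inv ?_ fun v hv => (hg _ (quantile_mem_Ioo hA hF hb hv)).ne'
    exact hc.comp (by exact_mod_cast hq) fun v hv => quantile_mem_Ioo hA hF hb hv

theorem HasDensityOn.hasRegularQuantile (h : HasDensityOn ν₀ A ψ₀) (hA : 0 < A)
    (hc : ContinuousOn ψ₀ (Ioo 0 A)) (hg : ∀ x ∈ Ioo 0 A, 0 < ψ₀ x) :
    HasRegularQuantile ν₀ A where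
  pos := hA
  strictMonoOn := h.strictMonoOn_distFun hc hg hA.le
  bijOn := h.bijOn_distFun hc hg hA.le
  contDiffOn := by simpa using h.contDiffOn_quantile hA hg 0 (by simpa using hc)
  deriv_pos v hv := by
    rw [(h.hasDerivAt_quantile hA hc hg hv).deriv]
    exact inv_pos.2 (hg _ (quantile_mem_Ioo hA (h.strictMonoOn_distFun hc hg hA.le)
      (h.bijOn_distFun hc hg hA.le) hv))

end OfDensity

/-! ### The flow of a smooth quantile function -/

/-- The function `k(v) = q(v) / v`, where `q` is the quantile function of `ν`. -/
noncomputable def quantileRatio (ν : Measure ℝ) (v : ℝ) : ℝ := quantile ν v / v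

/-- The derivative in `s` of `s k(s + t)`, the quantile function of `(1 - t) ν_t`. -/
noncomputable def flowJac (ν : Measure ℝ) (t s : ℝ) : ℝ :=
  quantileRatio ν (s + t) + s * deriv (quantileRatio ν) (s + t)

theorem contDiffOn_quantileRatio {ν : Measure ℝ} {n : WithTop ℕ∞}
    (h : ContDiffOn ℝ n (quantile ν) (Ioo 0 1)) :
    ContDiffOn ℝ n (quantileRatio ν) (Ioo 0 1) :=
  h.div contDiffOn_id fun _ hv => hv.1.ne'

theorem flowRadius_eq_mul (ν : Measure ℝ) {t s : ℝ} (h : s + t ≠ 0) :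
    flowRadius ν t (s + t) = s * quantileRatio ν (s + t) := by
  rw [flowRadius_add ν h, quantileRatio, mul_div_assoc]

theorem add_mem_Ioo {t s : ℝ} (ht : t ∈ Ico (0 : ℝ) 1) (hs : s ∈ Ioo 0 (1 - t)) :
    s + t ∈ Ioo (0 : ℝ) 1 :=
  ⟨add_pos_of_pos_of_nonneg hs.1 ht.1, by linarith [hs.2]⟩

theorem eventually_mem_region {A t x : ℝ} (hp : (t, x) ∈ region A) :
    ∀ᶠ u in 𝓝[Ico 0 1] t, (u, x) ∈ region A := by
  have h1 : ∀ᶠ u in 𝓝 t, x < A * (1 - u) :=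
    continuousAt_const.eventually_lt (by fun_prop) hp.2.2
  filter_upwards [self_mem_nhdsWithin, nhdsWithin_le_nhds h1] with u hu hxu
  exact ⟨hu, hp.2.1, hxu⟩

namespace HasRegularQuantile

variable {ν₀ : Measure ℝ} {A : ℝ} (H : HasRegularQuantile ν₀ A)

include H

theorem hasDerivAt_quantileRatio {v : ℝ} (hv : v ∈ Ioo (0 : ℝ) 1) :
    HasDerivAt (quantileRatio ν₀) (deriv (quantileRatio ν₀) v) v :=
  (((contDiffOn_quantileRatio H.contDiffOn).differentiableOn one_ne_zero).differentiableAt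
    (Ioo_mem_nhds hv.1 hv.2)).hasDerivAt

theorem flowJac_pos {t s : ℝ} (ht : t ∈ Ico (0 : ℝ) 1) (hs : s ∈ Ioo 0 (1 - t)) :
    0 < flowJac ν₀ t s := by
  have hv := add_mem_Ioo ht hs
  have hq : HasDerivAt (quantile ν₀) (deriv (quantile ν₀) (s + t)) (s + t) :=
    ((H.contDiffOn.differentiableOn one_ne_zero).differentiableAt
      (Ioo_mem_nhds hv.1 hv.2)).hasDerivAt
  have hk : deriv (quantileRatio ν₀) (s + t) =
      (deriv (quantile ν₀) (s + t) * (s + t) - quantile ν₀ (s + t) * 1) / (s + t) ^ 2 :=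
    (hq.div (hasDerivAt_id (s + t)) hv.1.ne').deriv
  have hne := hv.1.ne'
  have : flowJac ν₀ t s = t * quantile ν₀ (s + t) / (s + t) ^ 2 +
      s * deriv (quantile ν₀) (s + t) / (s + t) := by
    rw [flowJac, hk, quantileRatio]
    field_simp
    ring
  rw [this]
  have h1 := quantile_nonneg ν₀ (s + t)
  have h2 := H.deriv_pos _ hv
  have h3 := ht.1
  have h4 := hs.1
  have h5 := hv.1
  positivity

theorem hasDerivAt_flowRadius {t s : ℝ} (ht : t ∈ Ico (0 : ℝ) 1) (hs : s ∈ Ioo 0 (1 - t)) :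
    HasDerivAt (fun s => flowRadius ν₀ t (s + t)) (flowJac ν₀ t s) s := by
  have hv := add_mem_Ioo ht hs
  have h1 : HasDerivAt (fun s => s * quantileRatio ν₀ (s + t)) (flowJac ν₀ t s) s := by
    have h2 := (hasDerivAt_id s).mul
      ((H.hasDerivAt_quantileRatio hv).comp s ((hasDerivAt_id s).add_const t))
    convert! h2 using 1
    simp [flowJac]
  refine h1.congr_of_eventuallyEq ?_
  filter_upwards [Ioi_mem_nhds hs.1] with u hu
  exact flowRadius_eq_mul ν₀ (add_pos_of_pos_of_nonneg hu ht.1).ne'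

variable [IsProbabilityMeasure ν₀] (hsupp : ∃ R : ℝ, ν₀ (Icc 0 R)ᶜ = 0)

include hsupp

theorem Psi_mem_Ioo {t x : ℝ} (hp : (t, x) ∈ region A) : Psi ν₀ t x ∈ Ioo 0 (1 - t) := by
  obtain ⟨ht, hx⟩ : t ∈ Ico (0 : ℝ) 1 ∧ x ∈ Ioo 0 (A * (1 - t)) := hp
  have hB : 0 ≤ A * (1 - t) := hx.1.le.trans hx.2.le
  have hm := strictMonoOn_Psi hsupp H.pos H.strictMonoOn H.bijOn ht
  have hx' := Ioo_subset_Icc_self hx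
  exact ⟨(Psi_nonneg _ _ _).trans_lt (hm (left_mem_Icc.2 hB) hx' hx.1),
    (hm hx' (right_mem_Icc.2 hB) hx.2).trans_le (Psi_le hsupp ht _)⟩

theorem flowRadius_Psi {t x : ℝ} (hp : (t, x) ∈ region A) :
    flowRadius ν₀ t (Psi ν₀ t x + t) = x :=
  (invOn_flowRadius_Psi hsupp H.pos H.strictMonoOn H.bijOn hp.1).1 (Ioo_subset_Icc_self hp.2)

theorem Psi_mul_quantileRatio {t x : ℝ} (hp : (t, x) ∈ region A) :
    Psi ν₀ t x * quantileRatio ν₀ (Psi ν₀ t x + t) = x := by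
  rw [← flowRadius_eq_mul ν₀ (add_mem_Ioo hp.1 (H.Psi_mem_Ioo hsupp hp)).1.ne']
  exact H.flowRadius_Psi hsupp hp

theorem hasDerivAt_Psi {t x : ℝ} (hp : (t, x) ∈ region A) :
    HasDerivAt (Psi ν₀ t) (flowJac ν₀ t (Psi ν₀ t x))⁻¹ x := by
  have hs := H.Psi_mem_Ioo hsupp hp
  have hnhds : Ioo 0 (A * (1 - t)) ∈ 𝓝 x := Ioo_mem_nhds hp.2.1 hp.2.2
  refine HasDerivAt.of_local_left_inverse (f := fun s => flowRadius ν₀ t (s + t)) ?_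
    (H.hasDerivAt_flowRadius hp.1 hs) (H.flowJac_pos hp.1 hs).ne' ?_
  · exact (continuousOn_Psi hsupp H.pos H.strictMonoOn H.bijOn hp.1).continuousAt
      (mem_of_superset hnhds Ioo_subset_Icc_self)
  · filter_upwards [hnhds] with y hy using H.flowRadius_Psi hsupp ⟨hp.1, hy⟩

theorem psi_eq {t x : ℝ} (hp : (t, x) ∈ region A) :
    psi ν₀ t x = (flowJac ν₀ t (Psi ν₀ t x))⁻¹ :=
  (H.hasDerivAt_Psi hsupp hp).deriv

theorem psi_pos {t x : ℝ} (hp : (t, x) ∈ region A) : 0 < psi ν₀ t x := by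
  rw [H.psi_eq hsupp hp]
  exact inv_pos.2 (H.flowJac_pos hp.1 (H.Psi_mem_Ioo hsupp hp))

theorem Psi_zero {t : ℝ} (ht : t ∈ Ico (0 : ℝ) 1) : Psi ν₀ t 0 = 0 := by
  have h := Psi_flowRadius hsupp H.strictMonoOn H.bijOn ht
    (left_mem_Icc.2 (sub_nonneg.2 ht.2.le))
  rwa [zero_add, flowRadius_self] at h

theorem massFlow_compl_Icc {t : ℝ} (ht : t ∈ Ico (0 : ℝ) 1) :
    massFlow ν₀ t (Icc 0 (A * (1 - t)))ᶜ = 0 := by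
  rw [massFlow_apply hsupp ht measurableSet_Icc.compl]
  convert measure_empty (μ := (volume : Measure ℝ))
  ext v
  simp only [mem_inter_iff, mem_preimage, mem_compl_iff, mem_empty_iff_false, iff_false, not_and,
    not_imp_not]
  intro hv
  have h := (bijOn_flowRadius H.pos H.strictMonoOn H.bijOn ht).mapsTo (x := v - t)
    ⟨by linarith [hv.1], by linarith [hv.2]⟩
  simpa using h

theorem continuous_Psi {t : ℝ} (ht : t ∈ Ico (0 : ℝ) 1) : Continuous (Psi ν₀ t) := by
  have hB : 0 ≤ A * (1 - t) := mul_nonneg H.pos.le (sub_nonneg.2 ht.2.le)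
  have hc := continuousOn_Psi hsupp H.pos H.strictMonoOn H.bijOn ht
  -- `Ψ_t` is constant to the left of `0` and to the right of `A (1 - t)`
  have he : Psi ν₀ t = IccExtend hB ((Icc 0 (A * (1 - t))).domRestrict (Psi ν₀ t)) := by
    ext x
    rcases lt_or_ge x 0 with hx | hx
    · rw [IccExtend_of_le_left _ _ hx.le, domRestrict_apply, H.Psi_zero hsupp ht]
      simp [Psi, distFun, Icc_eq_empty (not_le.2 hx)]
    · rcases le_or_gt x (A * (1 - t)) with hx' | hx'
      · rw [IccExtend_of_mem _ _ ⟨hx, hx'⟩, domRestrict_apply]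
      · rw [IccExtend_of_right_le _ _ hx'.le, domRestrict_apply]
        refine le_antisymm ?_ (Psi_mono ν₀ t hx'.le)
        have h1 : Psi ν₀ t (A * (1 - t)) = (massFlow ν₀ t).real univ := by
          rw [Psi, distFun, measureReal_def, measureReal_def]
          congr 1
          exact measure_of_measure_compl_eq_zero (H.massFlow_compl_Icc hsupp ht)
        rw [h1]
        exact measureReal_mono (subset_univ _)
  rw [he]
  exact (continuousOn_iff_continuous_domRestrict.1 hc).Icc_extend'

theorem hasDensityOn_massFlow {t : ℝ} (ht : t ∈ Ico (0 : ℝ) 1) :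
    HasDensityOn (massFlow ν₀ t) (A * (1 - t)) (psi ν₀ t) := by
  have hB : 0 ≤ A * (1 - t) := mul_nonneg H.pos.le (sub_nonneg.2 ht.2.le)
  refine hasDensityOn_of_hasDerivAt hB (H.massFlow_compl_Icc hsupp ht)
    (H.continuous_Psi hsupp ht).continuousOn (H.Psi_zero hsupp ht) (fun x hx => ?_)
    fun x hx => (H.psi_pos hsupp ⟨ht, hx⟩).le
  rw [H.psi_eq hsupp ⟨ht, hx⟩]
  exact H.hasDerivAt_Psi hsupp ⟨ht, hx⟩

theorem integral_psi {t x : ℝ} (hp : (t, x) ∈ region A) :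
    ∫ u in (0 : ℝ)..x, psi ν₀ t u = Psi ν₀ t x := by
  have hd : ∀ u ∈ Ioo 0 x, HasDerivAt (Psi ν₀ t) (psi ν₀ t u) u := fun u hu => by
    have hu' : (t, u) ∈ region A := ⟨hp.1, hu.1, hu.2.trans hp.2.2⟩
    rw [H.psi_eq hsupp hu']
    exact H.hasDerivAt_Psi hsupp hu'
  have hc := (H.continuous_Psi hsupp hp.1).continuousOn (s := Icc 0 x)
  rw [intervalIntegral.integral_eq_sub_of_hasDerivAt_of_le hp.2.1.le hc hd, H.Psi_zero hsupp hp.1,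
    sub_zero]
  exact (intervalIntegrable_iff_integrableOn_Ioc_of_le hp.2.1.le).2
    (intervalIntegral.integrableOn_deriv_of_nonneg hc hd fun u hu =>
      (H.psi_pos hsupp (t := t) (x := u) ⟨hp.1, hu.1, hu.2.trans hp.2.2⟩).le)

/-- By the inverse function theorem for `(t, s) ↦ (t, s k(s + t))`, the map `(t, x) ↦ Ψ_t(x)` is,
near each point of the region, the restriction of a `C¹` function defined on an open set, also when
`t = 0`. -/
theorem contDiffOn_Psi : ContDiffOn ℝ 1 (fun p : ℝ × ℝ => Psi ν₀ p.1 p.2) (region A) := by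
  rintro ⟨t, x⟩ hp
  set s := Psi ν₀ t x with hs_def
  have hs : s ∈ Ioo 0 (1 - t) := H.Psi_mem_Ioo hsupp hp
  have ht : t ∈ Ico (0 : ℝ) 1 := hp.1
  have hv := add_mem_Ioo ht hs
  have hJ : flowJac ν₀ t s ≠ 0 := (H.flowJac_pos hp.1 hs).ne'
  set J := flowJac ν₀ t s with hJ_def
  set c := s * deriv (quantileRatio ν₀) (s + t) with hc_def
  let Φ : ℝ × ℝ → ℝ × ℝ := fun p => (p.1, p.2 * quantileRatio ν₀ (p.2 + p.1))
  let e : (ℝ × ℝ) ≃L[ℝ] (ℝ × ℝ) := ContinuousLinearEquiv.equivOfInverse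
    ((ContinuousLinearMap.fst ℝ ℝ ℝ).prod
      (c • ContinuousLinearMap.fst ℝ ℝ ℝ + J • ContinuousLinearMap.snd ℝ ℝ ℝ))
    ((ContinuousLinearMap.fst ℝ ℝ ℝ).prod
      (J⁻¹ • (ContinuousLinearMap.snd ℝ ℝ ℝ - c • ContinuousLinearMap.fst ℝ ℝ ℝ)))
    (fun p => by ext <;> simp [hJ]) (fun p => by ext <;> simp [hJ])
  have hΦ : ContDiffAt ℝ 1 Φ (t, s) := by
    have h1 : ContDiffAt ℝ 1 (quantileRatio ν₀) (s + t) :=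
      (contDiffOn_quantileRatio H.contDiffOn).contDiffAt (Ioo_mem_nhds hv.1 hv.2)
    have h2 : ContDiffAt ℝ 1 (fun p : ℝ × ℝ => quantileRatio ν₀ (p.2 + p.1)) (t, s) :=
      ContDiffAt.comp (t, s) (g := quantileRatio ν₀) (f := fun p : ℝ × ℝ => p.2 + p.1) h1
        (contDiffAt_snd.add contDiffAt_fst)
    exact contDiffAt_fst.prodMk (contDiffAt_snd.mul h2)
  have hΦ' : HasFDerivAt Φ (e : (ℝ × ℝ) →L[ℝ] (ℝ × ℝ)) (t, s) := by
    have h2 : HasFDerivAt (fun p : ℝ × ℝ => quantileRatio ν₀ (p.2 + p.1))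
        (deriv (quantileRatio ν₀) (s + t) •
          (ContinuousLinearMap.snd ℝ ℝ ℝ + ContinuousLinearMap.fst ℝ ℝ ℝ)) (t, s) :=
      HasDerivAt.comp_hasFDerivAt (t, s) (h₂ := quantileRatio ν₀) (f := fun p : ℝ × ℝ => p.2 + p.1)
        (H.hasDerivAt_quantileRatio hv) (hasFDerivAt_snd.add hasFDerivAt_fst)
    convert! hasFDerivAt_fst.prodMk (hasFDerivAt_snd.mul h2) using 1
    ext <;> simp [e, hc_def, hJ_def, flowJac]; ring
  have himg : Φ (t, s) = (t, x) := by
    simp only [Φ]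
    rw [H.Psi_mul_quantileRatio hsupp hp]
  have hg := hΦ.to_localInverse hΦ' one_ne_zero
  set g := hΦ.localInverse hΦ' one_ne_zero with hg_def
  have hgx : g (t, x) = (t, s) := by
    rw [← himg]
    exact hΦ.localInverse_apply_image hΦ' one_ne_zero
  have hright : ∀ᶠ p in 𝓝 (t, x), Φ (g p) = p := by
    rw [← himg]
    exact (hΦ.hasStrictFDerivAt' hΦ' one_ne_zero).eventually_right_inverse
  rw [himg] at hg
  have hgs : ∀ᶠ p in 𝓝 (t, x), (g p).2 ∈ Ioo 0 (1 - p.1) := by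
    have hcont : ContinuousAt (fun p => (g p).2) (t, x) := continuousAt_snd.comp hg.continuousAt
    have h0 : (g (t, x)).2 = s := by rw [hgx]
    have e1 : ∀ᶠ p in 𝓝 (t, x), 0 < (g p).2 :=
      continuousAt_const.eventually_lt hcont (by rw [h0]; exact hs.1)
    have e2 : ∀ᶠ p : ℝ × ℝ in 𝓝 (t, x), (g p).2 < 1 - p.1 :=
      hcont.eventually_lt (continuousAt_const.sub continuousAt_fst) (by rw [h0]; exact hs.2)
    exact e1.and e2
  have heq : ∀ p ∈ region A, Φ (g p) = p → (g p).2 ∈ Ioo 0 (1 - p.1) →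
      Psi ν₀ p.1 p.2 = (g p).2 := by
    intro p hpr h1 h2
    have h3 : (g p).1 = p.1 := show (Φ (g p)).1 = p.1 by rw [h1]
    have h4 : (g p).2 * quantileRatio ν₀ ((g p).2 + (g p).1) = p.2 :=
      show (Φ (g p)).2 = p.2 by rw [h1]
    rw [h3] at h4
    rw [← h4, ← flowRadius_eq_mul ν₀ (add_mem_Ioo hpr.1 h2).1.ne']
    exact Psi_flowRadius hsupp H.strictMonoOn H.bijOn hpr.1 (Ioo_subset_Icc_self h2)
  refine ((contDiffAt_snd.comp (t, x) hg).contDiffWithinAt (s := region A)).congr_of_eventuallyEq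
    ?_ (heq _ hp hright.self_of_nhds hgs.self_of_nhds)
  filter_upwards [self_mem_nhdsWithin, nhdsWithin_le_nhds hright, nhdsWithin_le_nhds hgs]
    with p h1 h2 h3 using heq p h1 h2 h3

/-- Obtained by differentiating the identity `Ψ_t(x) k(Ψ_t(x) + t) = x` in `t`. -/
theorem hasDerivWithinAt_Psi {t x : ℝ} (hp : (t, x) ∈ region A) :
    HasDerivWithinAt (fun u => Psi ν₀ u x)
      (quantileRatio ν₀ (Psi ν₀ t x + t) * (flowJac ν₀ t (Psi ν₀ t x))⁻¹ - 1) (Ico 0 1) t := by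
  have hs := H.Psi_mem_Ioo hsupp hp
  have ht : t ∈ Ico (0 : ℝ) 1 := hp.1
  have hv := add_mem_Ioo ht hs
  have hJ := (H.flowJac_pos ht hs).ne'
  obtain ⟨D, hD⟩ : ∃ D, HasDerivWithinAt (fun u => Psi ν₀ u x) D (Ico 0 1) t := by
    have h1 := ((H.contDiffOn_Psi hsupp).differentiableOn one_ne_zero (t, x) hp).hasFDerivWithinAt
    have h2 : HasDerivWithinAt (fun u : ℝ => (u, x)) (1, 0) {u | (u, x) ∈ region A} t :=
      (hasDerivWithinAt_id t _).prodMk (hasDerivWithinAt_const t _ x)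
    have h3 := h1.comp_hasDerivWithinAt t h2 fun u hu => hu
    exact ⟨_, h3.mono_of_mem_nhdsWithin (eventually_mem_region hp)⟩
  have hk : HasDerivWithinAt (fun u => quantileRatio ν₀ (Psi ν₀ u x + u))
      (deriv (quantileRatio ν₀) (Psi ν₀ t x + t) * (D + 1)) (Ico 0 1) t :=
    HasDerivAt.comp_hasDerivWithinAt (h₂ := quantileRatio ν₀) (h := fun u => Psi ν₀ u x + u) t
      (H.hasDerivAt_quantileRatio hv) (hD.add (hasDerivWithinAt_id t (Ico 0 1)))
  have heq : (fun _ : ℝ => x) =ᶠ[𝓝[Ico 0 1] t]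
      (fun u => Psi ν₀ u x) * fun u => quantileRatio ν₀ (Psi ν₀ u x + u) := by
    filter_upwards [eventually_mem_region hp] with u hu
    exact (H.Psi_mul_quantileRatio hsupp hu).symm
  have h5 := (hD.mul hk).congr_of_eventuallyEq heq (H.Psi_mul_quantileRatio hsupp hp).symm
  have huniq := (uniqueDiffOn_Ico (0 : ℝ) 1 t hp.1).eq_deriv _ h5 (hasDerivWithinAt_const t _ x)
  convert hD using 1
  rw [eq_comm, eq_sub_iff_add_eq, eq_mul_inv_iff_mul_eq₀ hJ, flowJac]
  linear_combination huniq

/-- The mean of `ψ(·, t)` over `[0, x]` is `Ψ_t(x) / x = 1 / k(Ψ_t(x) + t)`. -/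
theorem psi_div_mean {t x : ℝ} (hp : (t, x) ∈ region A) :
    psi ν₀ t x / ((1 / x) * ∫ u in (0 : ℝ)..x, psi ν₀ t u) =
      quantileRatio ν₀ (Psi ν₀ t x + t) * (flowJac ν₀ t (Psi ν₀ t x))⁻¹ := by
  have hx : x ≠ 0 := hp.2.1.ne'
  have hs := (H.Psi_mem_Ioo hsupp hp).1.ne'
  have h := H.Psi_mul_quantileRatio hsupp hp
  rw [H.integral_psi hsupp hp, H.psi_eq hsupp hp]
  generalize quantileRatio ν₀ (Psi ν₀ t x + t) = k at *
  generalize (flowJac ν₀ t (Psi ν₀ t x))⁻¹ = J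
  field_simp
  linear_combination (-J) * h

theorem hasDerivWithinAt_Psi_eq {t x : ℝ} (hp : (t, x) ∈ region A) :
    HasDerivWithinAt (fun u => Psi ν₀ u x) (x * (psi ν₀ t x / Psi ν₀ t x) - 1) (Ico 0 1) t := by
  have hs := (H.Psi_mem_Ioo hsupp hp).1.ne'
  convert H.hasDerivWithinAt_Psi hsupp hp using 2
  rw [H.psi_eq hsupp hp]
  nth_rewrite 1 [← H.Psi_mul_quantileRatio hsupp hp]
  field_simp

/-! ### Flows of twice differentiable quantile functions -/

variable (hq : ContDiffOn ℝ 2 (quantile ν₀) (Ioo 0 1))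

include hq

omit H [IsProbabilityMeasure ν₀] hsupp in
theorem contDiffOn_deriv_quantileRatio :
    ContDiffOn ℝ 1 (deriv (quantileRatio ν₀)) (Ioo 0 1) :=
  (contDiffOn_quantileRatio hq).deriv_of_isOpen isOpen_Ioo (by norm_num)

theorem contDiffOn_psi : ContDiffOn ℝ 1 (fun p : ℝ × ℝ => psi ν₀ p.1 p.2) (region A) := by
  have hΨ := H.contDiffOn_Psi hsupp
  have hm : MapsTo (fun p : ℝ × ℝ => Psi ν₀ p.1 p.2 + p.1) (region A) (Ioo 0 1) :=
    fun p hp => add_mem_Ioo hp.1 (H.Psi_mem_Ioo hsupp hp)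
  have hv : ContDiffOn ℝ 1 (fun p : ℝ × ℝ => Psi ν₀ p.1 p.2 + p.1) (region A) :=
    hΨ.add contDiffOn_fst
  have hJ : ContDiffOn ℝ 1 (fun p : ℝ × ℝ => flowJac ν₀ p.1 (Psi ν₀ p.1 p.2)) (region A) :=
    ((contDiffOn_quantileRatio H.contDiffOn).comp hv hm).add
      (hΨ.mul ((contDiffOn_deriv_quantileRatio hq).comp hv hm))
  exact (hJ.inv fun p hp => (H.flowJac_pos hp.1 (H.Psi_mem_Ioo hsupp hp)).ne').congr
    fun p hp => H.psi_eq hsupp hp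

omit H [IsProbabilityMeasure ν₀] hsupp in
theorem hasDerivAt_deriv_quantileRatio {v : ℝ} (hv : v ∈ Ioo (0 : ℝ) 1) :
    HasDerivAt (deriv (quantileRatio ν₀)) (deriv (deriv (quantileRatio ν₀)) v) v :=
  (((contDiffOn_deriv_quantileRatio hq).differentiableOn one_ne_zero).differentiableAt
    (Ioo_mem_nhds hv.1 hv.2)).hasDerivAt

/-- The left-hand side of the equation for `ψ`, expressed through `k` and its derivatives; it agrees
with the right-hand side computed in `hasDerivAt_psi_div_mean`. -/
theorem hasDerivWithinAt_psi {t x : ℝ} (hp : (t, x) ∈ region A) {k κ κ' s J : ℝ}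
    (hs_def : s = Psi ν₀ t x) (hk : k = quantileRatio ν₀ (s + t))
    (hκ : κ = deriv (quantileRatio ν₀) (s + t))
    (hκ' : κ' = deriv (deriv (quantileRatio ν₀)) (s + t)) (hJ : J = flowJac ν₀ t s) :
    HasDerivWithinAt (fun u => psi ν₀ u x) (κ / J ^ 2 - k * (2 * κ + s * κ') / J ^ 3)
      (Ico 0 1) t := by
  have ht : t ∈ Ico (0 : ℝ) 1 := hp.1
  have hs := H.Psi_mem_Ioo hsupp hp
  have hΨ := H.hasDerivWithinAt_Psi hsupp hp
  rw [← hs_def] at hs hΨ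
  rw [← hk, ← hJ] at hΨ
  have hv := add_mem_Ioo ht hs
  have hJ0 : J ≠ 0 := hJ ▸ (H.flowJac_pos ht hs).ne'
  have hv' : HasDerivWithinAt (fun u => Psi ν₀ u x + u) (k * J⁻¹ - 1 + 1) (Ico 0 1) t :=
    hΨ.add (hasDerivWithinAt_id t _)
  have h1 : HasDerivWithinAt (fun u => quantileRatio ν₀ (Psi ν₀ u x + u))
      (κ * (k * J⁻¹ - 1 + 1)) (Ico 0 1) t :=
    HasDerivAt.comp_hasDerivWithinAt (h₂ := quantileRatio ν₀) (h := fun u => Psi ν₀ u x + u) t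
      (by rw [← hs_def, hκ]; exact H.hasDerivAt_quantileRatio hv) hv'
  have h2 : HasDerivWithinAt (fun u => deriv (quantileRatio ν₀) (Psi ν₀ u x + u))
      (κ' * (k * J⁻¹ - 1 + 1)) (Ico 0 1) t :=
    HasDerivAt.comp_hasDerivWithinAt (h₂ := deriv (quantileRatio ν₀))
      (h := fun u => Psi ν₀ u x + u) t
      (by rw [← hs_def, hκ']; exact hasDerivAt_deriv_quantileRatio hq hv) hv'
  have h3 : HasDerivWithinAt (fun u => flowJac ν₀ u (Psi ν₀ u x))
      (κ * (k * J⁻¹ - 1 + 1) + ((k * J⁻¹ - 1) * κ + s * (κ' * (k * J⁻¹ - 1 + 1))))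
      (Ico 0 1) t := by
    have h4 := h1.add (hΨ.mul h2)
    rw [← hs_def, ← hκ] at h4
    exact h4
  have h5 := h3.fun_inv (by rw [← hs_def, ← hJ]; exact hJ0)
  rw [← hs_def, ← hJ] at h5
  have heq : (fun u => psi ν₀ u x) =ᶠ[𝓝[Ico 0 1] t] fun u => (flowJac ν₀ u (Psi ν₀ u x))⁻¹ := by
    filter_upwards [eventually_mem_region hp] with u hu using H.psi_eq hsupp hu
  have h6 := h5.congr_of_eventuallyEq heq (H.psi_eq hsupp hp)
  refine h6.congr_deriv ?_
  field_simp
  ring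

theorem hasDerivAt_psi_div_mean {t x : ℝ} (hp : (t, x) ∈ region A) {k κ κ' s J : ℝ}
    (hs_def : s = Psi ν₀ t x) (hk : k = quantileRatio ν₀ (s + t))
    (hκ : κ = deriv (quantileRatio ν₀) (s + t))
    (hκ' : κ' = deriv (deriv (quantileRatio ν₀)) (s + t)) (hJ : J = flowJac ν₀ t s) :
    HasDerivAt (fun y => psi ν₀ t y / ((1 / y) * ∫ u in (0 : ℝ)..y, psi ν₀ t u))
      (κ / J ^ 2 - k * (2 * κ + s * κ') / J ^ 3) x := by
  have ht : t ∈ Ico (0 : ℝ) 1 := hp.1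
  have hs := H.Psi_mem_Ioo hsupp hp
  have hΨ := H.hasDerivAt_Psi hsupp hp
  rw [← hs_def] at hs hΨ
  rw [← hJ] at hΨ
  have hv := add_mem_Ioo ht hs
  have hJ0 : J ≠ 0 := hJ ▸ (H.flowJac_pos ht hs).ne'
  have hv' : HasDerivAt (fun y => Psi ν₀ t y + t) J⁻¹ x := hΨ.add_const t
  have h1 : HasDerivAt (fun y => quantileRatio ν₀ (Psi ν₀ t y + t)) (κ * J⁻¹) x :=
    HasDerivAt.comp (h₂ := quantileRatio ν₀) (h := fun y => Psi ν₀ t y + t) x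
      (by rw [← hs_def, hκ]; exact H.hasDerivAt_quantileRatio hv) hv'
  have h2 : HasDerivAt (fun y => deriv (quantileRatio ν₀) (Psi ν₀ t y + t)) (κ' * J⁻¹) x :=
    HasDerivAt.comp (h₂ := deriv (quantileRatio ν₀)) (h := fun y => Psi ν₀ t y + t) x
      (by rw [← hs_def, hκ']; exact hasDerivAt_deriv_quantileRatio hq hv) hv'
  have h3 : HasDerivAt (fun y => flowJac ν₀ t (Psi ν₀ t y))
      (κ * J⁻¹ + (J⁻¹ * κ + s * (κ' * J⁻¹))) x := by
    have h4 := h1.add (hΨ.mul h2)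
    rw [← hs_def, ← hκ] at h4
    exact h4
  have h5 := h1.mul (h3.fun_inv (by rw [← hs_def, ← hJ]; exact hJ0))
  rw [← hs_def, ← hJ, ← hk] at h5
  have heq : (fun y => psi ν₀ t y / ((1 / y) * ∫ u in (0 : ℝ)..y, psi ν₀ t u)) =ᶠ[𝓝 x]
      (fun y => quantileRatio ν₀ (Psi ν₀ t y + t)) * fun y => (flowJac ν₀ t (Psi ν₀ t y))⁻¹ := by
    filter_upwards [Ioo_mem_nhds hp.2.1 hp.2.2] with y hy
    exact H.psi_div_mean hsupp (t := t) (x := y) ⟨ht, hy⟩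
  have h6 := h5.congr_of_eventuallyEq heq
  refine h6.congr_deriv ?_
  field_simp
  ring

end HasRegularQuantile

/-! ### Coefficients and moduli of roots -/

/-- The coefficients of a polynomial with nonnegative roots `a₀ ≤ a₁ ≤ ⋯` are, up to a binomial
coefficient, the products of its largest roots. -/
theorem coeff_prod_X_sub_C_bounds {a : ℕ → ℝ} (ha0 : ∀ i, 0 ≤ a i) (ham : Monotone a) (n k : ℕ)
    (hk : k ≤ n) :
    ∏ j ∈ Finset.Ico k n, a j ≤ ‖(∏ j ∈ Finset.range n, (X - C (a j : ℂ))).coeff k‖ ∧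
      ‖(∏ j ∈ Finset.range n, (X - C (a j : ℂ))).coeff k‖ ≤
        n.choose k * ∏ j ∈ Finset.Ico k n, a j := by
  have hP : ∀ k n : ℕ, 0 ≤ ∏ j ∈ Finset.Ico k n, a j := fun k n =>
    Finset.prod_nonneg fun j _ => ha0 j
  -- the signs of the coefficients alternate, so that no cancellation occurs
  have key : ∀ n k : ℕ, ∃ e : ℝ,
      (∏ j ∈ Finset.range n, (X - C (a j : ℂ))).coeff k = (-1) ^ (n + k) * (e : ℂ) ∧ 0 ≤ e ∧
      (k ≤ n → ∏ j ∈ Finset.Ico k n, a j ≤ e) ∧ e ≤ n.choose k * ∏ j ∈ Finset.Ico k n, a j := by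
    intro n
    induction n with
    | zero =>
      intro k
      rcases k with _ | k
      · exact ⟨1, by simp⟩
      · exact ⟨0, by simp [coeff_one]⟩
    | succ n ih =>
      intro k
      rw [Finset.prod_range_succ]
      rcases k with _ | k
      · obtain ⟨e, h1, h2, h3, h4⟩ := ih 0
        refine ⟨a n * e, ?_, mul_nonneg (ha0 n) h2, fun _ => ?_, ?_⟩
        · rw [mul_coeff_zero, h1]
          simp only [coeff_sub, coeff_X_zero, coeff_C_zero, Complex.ofReal_mul]
          ring
        · rw [Finset.prod_Ico_succ_top (Nat.zero_le n), mul_comm]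
          exact mul_le_mul_of_nonneg_left (h3 (Nat.zero_le n)) (ha0 n)
        · rw [Finset.prod_Ico_succ_top (Nat.zero_le n)]
          simp only [Nat.choose_zero_right, Nat.cast_one, one_mul] at h4 ⊢
          rw [mul_comm]
          exact mul_le_mul_of_nonneg_right h4 (ha0 n)
      · obtain ⟨e, h1, h2, h3, h4⟩ := ih k
        obtain ⟨e', h1', h2', h3', h4'⟩ := ih (k + 1)
        refine ⟨e + a n * e', ?_, add_nonneg h2 (mul_nonneg (ha0 n) h2'), fun hk => ?_, ?_⟩
        · rw [mul_sub, coeff_sub, coeff_mul_X, coeff_mul_C, h1, h1']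
          push_cast
          ring
        · rcases (Nat.succ_le_succ_iff.1 hk).eq_or_lt with rfl | hlt
          · have := h3 le_rfl
            simp only [Finset.Ico_self, Finset.prod_empty] at this ⊢
            linarith [mul_nonneg (ha0 k) h2']
          · rw [Finset.prod_Ico_succ_top hlt, mul_comm]
            have := mul_le_mul_of_nonneg_left (h3' hlt) (ha0 n)
            linarith
        · have e1 : (n.choose k : ℝ) * ∏ j ∈ Finset.Ico k n, a j ≤
              n.choose k * ∏ j ∈ Finset.Ico (k + 1) (n + 1), a j := by
            refine mul_le_mul_of_nonneg_left ?_ (Nat.cast_nonneg _)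
            rw [← Finset.prod_Ico_add' a k n 1]
            exact Finset.prod_le_prod (fun j _ => ha0 j) fun j _ => ham (Nat.le_succ j)
          have e2 : a n * e' ≤ n.choose (k + 1) * ∏ j ∈ Finset.Ico (k + 1) (n + 1), a j := by
            rcases lt_or_ge n (k + 1) with hlt | hle
            · rw [Nat.choose_eq_zero_of_lt hlt] at h4' ⊢
              have : e' = 0 := le_antisymm (by simpa using h4') h2'
              simp [this]
            · rw [Finset.prod_Ico_succ_top hle]
              have := mul_le_mul_of_nonneg_left h4' (ha0 n)
              linarith
          rw [Nat.choose_succ_succ]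
          push_cast
          linarith
  obtain ⟨e, h1, h2, h3, h4⟩ := key n k
  have hn : ‖(∏ j ∈ Finset.range n, (X - C (a j : ℂ))).coeff k‖ = e := by
    rw [h1]
    simp [abs_of_nonneg h2]
  rw [hn]
  exact ⟨h3 hk, h4⟩

/-- The Mahler measure of `p(R z)`. -/
theorem mahlerMeasure_comp_C_mul_X (p : ℂ[X]) {R : ℝ} (hR : 0 < R) :
    (p.comp (C (R : ℂ) * X)).mahlerMeasure =
      ‖p.leadingCoeff‖ * (p.roots.map fun w => max R ‖w‖).prod := by
  have h := (IsAlgClosed.splits p).eq_prod_roots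
  conv_lhs => rw [h]
  rw [mul_comp, C_comp, mahlerMeasure_mul, mahlerMeasure_const, multiset_prod_comp,
    prod_mahlerMeasure_eq_mahlerMeasure_prod, Multiset.map_map, Multiset.map_map]
  congr 3
  ext w
  have hR' : (R : ℂ) ≠ 0 := by exact_mod_cast hR.ne'
  have : (X - C w).comp (C (R : ℂ) * X) = C (R : ℂ) * X + C (-w) := by
    simp [sub_eq_add_neg]
  simp only [Function.comp_apply]
  rw [this, mahlerMeasure_C_mul_X_add_C hR', norm_neg]
  simp [abs_of_pos hR]

/-- For a nondecreasing sequence `ρ`, the product `∏ max R ρ_j` is one of the terms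
`R ^ k * ∏_{j ≥ k} ρ_j`. -/
theorem exists_prod_max_eq {ρ : ℕ → ℝ} (hρ : Monotone ρ) (R : ℝ) (n : ℕ) :
    ∃ k ≤ n, ∏ j ∈ Finset.range n, max R (ρ j) = R ^ k * ∏ j ∈ Finset.Ico k n, ρ j := by
  induction n with
  | zero => exact ⟨0, le_rfl, by simp⟩
  | succ n ih =>
    rcases le_total (ρ n) R with h | h
    · refine ⟨n + 1, le_rfl, ?_⟩
      rw [Finset.prod_congr rfl fun j hj => max_eq_left
        ((hρ (Nat.lt_succ_iff.1 (Finset.mem_range.1 hj))).trans h)]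
      simp
    · obtain ⟨k, hk, hp⟩ := ih
      refine ⟨k, hk.trans (Nat.le_succ n), ?_⟩
      rw [Finset.prod_range_succ, hp, Finset.prod_Ico_succ_top hk, max_eq_right h, mul_assoc]

theorem pow_mul_prod_Ico_le {ρ : ℕ → ℝ} (hρ0 : ∀ i, 0 ≤ ρ i) {R : ℝ} (hR : 0 ≤ R) {n k : ℕ}
    (hk : k ≤ n) :
    R ^ k * ∏ j ∈ Finset.Ico k n, ρ j ≤ ∏ j ∈ Finset.range n, max R (ρ j) := by
  rw [← Finset.prod_range_mul_prod_Ico _ hk]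
  refine mul_le_mul ?_ ?_ (Finset.prod_nonneg fun j _ => hρ0 j)
    (Finset.prod_nonneg fun j _ => hR.trans (le_max_left _ _))
  · calc R ^ k = ∏ j ∈ Finset.range k, R := by simp
      _ ≤ _ := Finset.prod_le_prod (fun _ _ => hR) fun j _ => le_max_left _ _
  · exact Finset.prod_le_prod (fun j _ => hρ0 j) fun j _ => le_max_right _ _

/-- If the coefficients of `T` are, up to binomial coefficients, those of a polynomial with
nonnegative roots `ρ₀ ≤ ρ₁ ≤ ⋯`, then `∏ max R |w|`, over the roots `w` of `T`, differs from
`∏ max R ρ_j` at most by a factor `2 ^ n`: both are comparable with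
`∑ k, |T_k| R ^ k`, the former by the theory of the Mahler measure. -/
theorem prod_max_roots_bounds {T : ℂ[X]} {n : ℕ} (hT : T.natDegree = n) (hT0 : T ≠ 0) {ρ : ℕ → ℝ}
    (hρ0 : ∀ i, 0 ≤ ρ i) (hρ : Monotone ρ)
    (hlow : ∀ k ≤ n, ‖T.leadingCoeff‖ * ∏ j ∈ Finset.Ico k n, ρ j ≤ ‖T.coeff k‖)
    (hup : ∀ k ≤ n, ‖T.coeff k‖ ≤ n.choose k * (‖T.leadingCoeff‖ * ∏ j ∈ Finset.Ico k n, ρ j))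
    {R : ℝ} (hR : 0 < R) :
    ∏ j ∈ Finset.range n, max R (ρ j) ≤ 2 ^ n * (T.roots.map fun w => max R ‖w‖).prod ∧
      (T.roots.map fun w => max R ‖w‖).prod ≤ 2 ^ n * ∏ j ∈ Finset.range n, max R (ρ j) := by
  have hL : 0 < ‖T.leadingCoeff‖ := norm_pos_iff.2 (leadingCoeff_ne_zero.2 hT0)
  have hM := mahlerMeasure_comp_C_mul_X T hR
  have hc : ∀ k, ‖(T.comp (C (R : ℂ) * X)).coeff k‖ = ‖T.coeff k‖ * R ^ k := fun k => by
    rw [comp_C_mul_X_coeff, norm_mul, norm_pow, Complex.norm_real, Real.norm_of_nonneg hR.le]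
  have hdeg : (T.comp (C (R : ℂ) * X)).natDegree = n := by
    rw [natDegree_comp, natDegree_C_mul_X _ (by exact_mod_cast hR.ne'), mul_one, hT]
  constructor
  · obtain ⟨k, hk, hp⟩ := exists_prod_max_eq hρ R n
    have h1 := norm_coeff_le_choose_mul_mahlerMeasure k (T.comp (C (R : ℂ) * X))
    rw [hc, hdeg, hM] at h1
    have h2 : (n.choose k : ℝ) ≤ 2 ^ n := by exact_mod_cast Nat.choose_le_two_pow n k
    have h3 : 0 ≤ (T.roots.map fun w => max R ‖w‖).prod := Multiset.prod_nonneg fun x hx => by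
      obtain ⟨w, -, rfl⟩ := Multiset.mem_map.1 hx
      exact hR.le.trans (le_max_left _ _)
    have h4 := mul_le_mul_of_nonneg_right (hlow k hk) (pow_nonneg hR.le k)
    refine le_of_mul_le_mul_left ?_ hL
    rw [hp]
    calc _ = ‖T.leadingCoeff‖ * (∏ j ∈ Finset.Ico k n, ρ j) * R ^ k := by ring
      _ ≤ _ := h4.trans h1
      _ ≤ 2 ^ n * (‖T.leadingCoeff‖ * (T.roots.map fun w => max R ‖w‖).prod) :=
        mul_le_mul_of_nonneg_right h2 (mul_nonneg hL.le h3)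
      _ = _ := by ring
  · have h1 := mahlerMeasure_le_sum_norm_coeff (T.comp (C (R : ℂ) * X))
    rw [hM, sum_over_range _ (fun _ => norm_zero), hdeg] at h1
    refine le_of_mul_le_mul_left (h1.trans ?_) hL
    have h2 : ∀ k ∈ Finset.range (n + 1), ‖(T.comp (C (R : ℂ) * X)).coeff k‖ ≤
        n.choose k * (‖T.leadingCoeff‖ * ∏ j ∈ Finset.range n, max R (ρ j)) := by
      intro k hk
      have hk' := Nat.lt_succ_iff.1 (Finset.mem_range.1 hk)
      rw [hc]
      calc ‖T.coeff k‖ * R ^ k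
          ≤ n.choose k * (‖T.leadingCoeff‖ * ∏ j ∈ Finset.Ico k n, ρ j) * R ^ k :=
            mul_le_mul_of_nonneg_right (hup k hk') (pow_nonneg hR.le k)
        _ = n.choose k * (‖T.leadingCoeff‖ * (R ^ k * ∏ j ∈ Finset.Ico k n, ρ j)) := by ring
        _ ≤ _ := mul_le_mul_of_nonneg_left (mul_le_mul_of_nonneg_left
            (pow_mul_prod_Ico_le hρ0 hR.le hk') hL.le) (Nat.cast_nonneg _)
    refine (Finset.sum_le_sum h2).trans (le_of_eq ?_)
    rw [← Finset.sum_mul]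
    have : ∑ k ∈ Finset.range (n + 1), (n.choose k : ℝ) = 2 ^ n := by
      exact_mod_cast Nat.sum_range_choose n
    rw [this]
    ring

/-! ### Derivatives of polynomials in `z ^ m` -/

/-- The polynomial `T` for which `z ^ N * (d / dz) ^ N p(z ^ m) = T(z ^ m)`: the `k`-th coefficient
of `p` is multiplied by the falling factorial `(m k) (m k - 1) ⋯ (m k - N + 1)`. -/
noncomputable def fallingWeight (p : ℂ[X]) (m N : ℕ) : ℂ[X] :=
  ∑ k ∈ Finset.range (p.natDegree + 1), monomial k (p.coeff k * ((m * k).descFactorial N : ℂ))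

theorem coeff_fallingWeight (p : ℂ[X]) (m N k : ℕ) :
    (fallingWeight p m N).coeff k = p.coeff k * ((m * k).descFactorial N : ℂ) := by
  rw [fallingWeight, finsetSum_coeff]
  simp only [coeff_monomial, Finset.sum_ite_eq', Finset.mem_range]
  split_ifs with h
  · rfl
  · rw [coeff_eq_zero_of_natDegree_lt (by omega), zero_mul]

theorem X_pow_mul_iterate_derivative_expand (p : ℂ[X]) {m : ℕ} (hm : 0 < m) (N : ℕ) :
    X ^ N * derivative^[N] (expand ℂ m p) = expand ℂ m (fallingWeight p m N) := by
  ext i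
  rw [coeff_X_pow_mul', coeff_expand hm, coeff_fallingWeight]
  split_ifs with h1 h2 h2
  · rw [coeff_iterate_derivative, Nat.sub_add_cancel h1, coeff_expand hm, if_pos h2,
      Nat.mul_div_cancel' h2, nsmul_eq_mul, mul_comm]
  · rw [coeff_iterate_derivative, Nat.sub_add_cancel h1, coeff_expand hm, if_neg h2, smul_zero]
  · rw [Nat.mul_div_cancel' h2, Nat.descFactorial_eq_zero_iff_lt.2 (not_le.1 h1)]
    simp
  · rfl

theorem samplePoly_eq_expand {n : ℕ} {r : Fin n → ℝ} {r' : ℕ → ℝ} (h : ∀ i : Fin n, r' i = r i)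
    (m : ℕ) :
    samplePoly r m = expand ℂ m (∏ j ∈ Finset.range n, (X - C ((r' j ^ m : ℝ) : ℂ))) := by
  rw [samplePoly, map_prod, Finset.prod_range]
  refine Finset.prod_congr rfl fun j _ => ?_
  rw [map_sub, expand_X, expand_C, h]
  push_cast
  rfl

theorem natDegree_fallingWeight {p : ℂ[X]} {n m N : ℕ} (hp : p.Monic) (hn : p.natDegree = n)
    (hN : N ≤ m * n) : (fallingWeight p m N).natDegree = n := by
  refine natDegree_eq_of_le_of_coeff_ne_zero ?_ ?_
  · refine natDegree_le_iff_coeff_eq_zero.2 fun k hk => ?_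
    rw [coeff_fallingWeight, coeff_eq_zero_of_natDegree_lt (hn ▸ hk), zero_mul]
  · rw [coeff_fallingWeight, ← hn, hp.coeff_natDegree, one_mul, hn, Nat.cast_ne_zero]
    exact fun h => absurd (Nat.descFactorial_eq_zero_iff_lt.1 h) (not_lt.2 hN)

/-- The quotient of consecutive weights in `fallingWeight`. -/
noncomputable def weightRatio (m N k : ℕ) : ℝ :=
  ((m * k).descFactorial N : ℝ) / ((m * (k + 1)).descFactorial N : ℝ)

theorem weightRatio_nonneg (m N k : ℕ) : 0 ≤ weightRatio m N k := by
  unfold weightRatio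
  positivity

theorem weightRatio_eq_zero {m N k : ℕ} (h : m * k < N) : weightRatio m N k = 0 := by
  rw [weightRatio, Nat.descFactorial_eq_zero_iff_lt.2 h]
  simp

theorem descFactorial_eq_weightRatio_mul (m N k : ℕ) :
    ((m * k).descFactorial N : ℝ) = weightRatio m N k * ((m * (k + 1)).descFactorial N : ℝ) := by
  rcases eq_or_ne ((m * (k + 1)).descFactorial N) 0 with h | h
  · have h1 := Nat.descFactorial_eq_zero_iff_lt.1 h
    have h2 : m * k < N := (Nat.mul_le_mul_left m (Nat.le_succ k)).trans_lt h1
    rw [h, Nat.descFactorial_eq_zero_iff_lt.2 h2]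
    simp
  · rw [weightRatio, div_mul_cancel₀ _ (Nat.cast_ne_zero.2 h)]

theorem descFactorial_eq_prod_weightRatio_mul (m N : ℕ) {k n : ℕ} (hk : k ≤ n) :
    ((m * k).descFactorial N : ℝ) =
      (∏ j ∈ Finset.Ico k n, weightRatio m N j) * ((m * n).descFactorial N : ℝ) := by
  induction n, hk using Nat.le_induction with
  | base => simp
  | succ n hn ih =>
    rw [ih, descFactorial_eq_weightRatio_mul m N n, Finset.prod_Ico_succ_top hn, mul_assoc]

theorem descFactorial_div_eq_prod {a N : ℕ} (h : N ≤ a) (m : ℕ) :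
    (a.descFactorial N : ℝ) / ((a + m).descFactorial N : ℝ) =
      ∏ i ∈ Finset.range m, (1 - (N : ℝ) / (a + i + 1 : ℕ)) := by
  have hne : ∀ b, N ≤ b → (b.descFactorial N : ℝ) ≠ 0 := fun b hb =>
    Nat.cast_ne_zero.2 fun h0 => absurd (Nat.descFactorial_eq_zero_iff_lt.1 h0) (not_lt.2 hb)
  induction m with
  | zero => simpa using div_self (hne a h)
  | succ m ih =>
    rw [Finset.prod_range_succ, ← ih]
    have h1 := hne (a + m) (by omega)
    have h2 := hne (a + (m + 1)) (by omega)
    have h3 : ((a + m + 1 : ℕ) - (N : ℝ)) * ((a + (m + 1)).descFactorial N : ℝ) =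
        (a + m + 1 : ℕ) * ((a + m).descFactorial N : ℝ) := by
      have := Nat.succ_descFactorial (a + m) N
      rw [← Nat.cast_sub (by omega)]
      exact_mod_cast this
    have h4 : ((a + m + 1 : ℕ) : ℝ) ≠ 0 := by positivity
    generalize ((a + m + 1 : ℕ) : ℝ) = c at *
    field_simp
    linear_combination (-(a.descFactorial N : ℝ)) * h3

theorem weightRatio_eq_prod {m N k : ℕ} (h : N ≤ m * k) :
    weightRatio m N k = ∏ i ∈ Finset.range m, (1 - (N : ℝ) / (m * k + i + 1 : ℕ)) := by
  rw [← descFactorial_div_eq_prod h m]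
  rfl

theorem one_sub_div_cast_nonneg {N a : ℕ} (h : N ≤ a) : 0 ≤ 1 - (N : ℝ) / a :=
  one_sub_div_nonneg (Nat.cast_nonneg N) (Nat.cast_le.2 h)

theorem one_sub_div_cast_mono {N a b : ℕ} (h : N ≤ a) (hab : a ≤ b) :
    1 - (N : ℝ) / a ≤ 1 - (N : ℝ) / b :=
  one_sub_div_mono (Nat.cast_nonneg N) (Nat.cast_le.2 h) (Nat.cast_le.2 hab)

theorem weightRatio_mono (m N : ℕ) : Monotone (weightRatio m N) := by
  intro k l hkl
  rcases lt_or_ge (m * k) N with h | h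
  · rw [weightRatio_eq_zero h]
    exact weightRatio_nonneg _ _ _
  · have hkl' := Nat.mul_le_mul_left m hkl
    rw [weightRatio_eq_prod h, weightRatio_eq_prod (h.trans hkl')]
    exact Finset.prod_le_prod (fun i _ => one_sub_div_cast_nonneg (by omega))
      fun i _ => one_sub_div_cast_mono (by omega) (by omega)

theorem pow_le_weightRatio {m N k : ℕ} (h : N ≤ m * k) :
    (1 - (N : ℝ) / (m * k : ℕ)) ^ m ≤ weightRatio m N k := by
  rw [weightRatio_eq_prod h]
  calc (1 - (N : ℝ) / (m * k : ℕ)) ^ m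
      = ∏ i ∈ Finset.range m, (1 - (N : ℝ) / (m * k : ℕ)) := by simp
    _ ≤ _ := Finset.prod_le_prod (fun i _ => one_sub_div_cast_nonneg h)
      fun i _ => one_sub_div_cast_mono h (by omega)

theorem weightRatio_le_pow {m N k : ℕ} (h : N ≤ m * k) :
    weightRatio m N k ≤ (1 - (N : ℝ) / (m * (k + 1) : ℕ)) ^ m := by
  rw [weightRatio_eq_prod h]
  calc _ ≤ ∏ i ∈ Finset.range m, (1 - (N : ℝ) / (m * (k + 1) : ℕ)) := by
        refine Finset.prod_le_prod (fun i _ => one_sub_div_cast_nonneg (by omega)) fun i hi => ?_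
        refine one_sub_div_cast_mono (by omega) ?_
        have := Finset.mem_range.1 hi
        rw [Nat.mul_succ]
        omega
    _ = _ := by simp

/-- The comparison of `prod_max_roots_bounds`, for the derivatives of `∏ (z ^ m - r_j ^ m)`. -/
theorem prod_max_roots_fallingWeight {r : ℕ → ℝ} (hr0 : ∀ i, 0 ≤ r i) (hr : Monotone r)
    {n m N : ℕ} (hN : N ≤ m * n) {R : ℝ} (hR : 0 < R) :
    let T := fallingWeight (∏ j ∈ Finset.range n, (X - C ((r j ^ m : ℝ) : ℂ))) m N
    ∏ j ∈ Finset.range n, max R (r j ^ m * weightRatio m N j) ≤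
        2 ^ n * (T.roots.map fun w => max R ‖w‖).prod ∧
      (T.roots.map fun w => max R ‖w‖).prod ≤
        2 ^ n * ∏ j ∈ Finset.range n, max R (r j ^ m * weightRatio m N j) := by
  intro T
  have hmonic : (∏ j ∈ Finset.range n, (X - C ((r j ^ m : ℝ) : ℂ))).Monic :=
    monic_prod_of_monic _ _ fun j _ => monic_X_sub_C _
  have hdeg : (∏ j ∈ Finset.range n, (X - C ((r j ^ m : ℝ) : ℂ))).natDegree = n := by
    rw [natDegree_prod_of_monic _ _ fun j _ => monic_X_sub_C _]
    simp only [natDegree_X_sub_C, Finset.sum_const, Finset.card_range, smul_eq_mul, mul_one]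
  have hT : T.natDegree = n := natDegree_fallingWeight hmonic hdeg hN
  have hlead : T.leadingCoeff = ((m * n).descFactorial N : ℂ) := by
    rw [leadingCoeff, hT, coeff_fallingWeight]
    nth_rewrite 2 [← hdeg]
    rw [hmonic.coeff_natDegree, one_mul]
  have hD : (m * n).descFactorial N ≠ 0 := fun h =>
    absurd (Nat.descFactorial_eq_zero_iff_lt.1 h) (not_lt.2 hN)
  have hT0 : T ≠ 0 := leadingCoeff_ne_zero.1 (by rw [hlead]; exact Nat.cast_ne_zero.2 hD)
  have hpow : Monotone fun j => r j ^ m := fun i j hij => pow_le_pow_left₀ (hr0 i) (hr hij) m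
  have hcoeff : ∀ k ≤ n, ‖T.coeff k‖ =
      ‖(∏ j ∈ Finset.range n, (X - C ((r j ^ m : ℝ) : ℂ))).coeff k‖ *
        ((∏ j ∈ Finset.Ico k n, weightRatio m N j) * ((m * n).descFactorial N : ℝ)) := by
    intro k hk
    rw [coeff_fallingWeight, norm_mul, Complex.norm_natCast,
      descFactorial_eq_prod_weightRatio_mul m N hk]
  have hw : ∀ k, 0 ≤ (∏ j ∈ Finset.Ico k n, weightRatio m N j) * ((m * n).descFactorial N : ℝ) :=
    fun k => mul_nonneg (Finset.prod_nonneg fun j _ => weightRatio_nonneg m N j)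
      (Nat.cast_nonneg _)
  refine prod_max_roots_bounds hT hT0
    (fun i => mul_nonneg (pow_nonneg (hr0 i) m) (weightRatio_nonneg m N i))
    (fun i j hij => mul_le_mul (hpow hij) (weightRatio_mono m N hij) (weightRatio_nonneg m N i)
      (pow_nonneg (hr0 j) m)) (fun k hk => ?_) (fun k hk => ?_) hR
  · have h1 := (coeff_prod_X_sub_C_bounds (fun i => pow_nonneg (hr0 i) m) hpow n k hk).1
    rw [hcoeff k hk, hlead, Complex.norm_natCast, Finset.prod_mul_distrib]
    calc _ = (∏ j ∈ Finset.Ico k n, r j ^ m) * ((∏ j ∈ Finset.Ico k n, weightRatio m N j) *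
          ((m * n).descFactorial N : ℝ)) := by ring
      _ ≤ _ := mul_le_mul_of_nonneg_right h1 (hw k)
  · have h1 := (coeff_prod_X_sub_C_bounds (fun i => pow_nonneg (hr0 i) m) hpow n k hk).2
    rw [hcoeff k hk, hlead, Complex.norm_natCast, Finset.prod_mul_distrib]
    calc _ ≤ _ := mul_le_mul_of_nonneg_right h1 (hw k)
      _ = _ := by ring

/-! ### Averages and quantiles -/

theorem measurable_comp_floor (g : ℕ → ℝ) (M : ℕ) : Measurable fun v : ℝ => g ⌊(M : ℝ) * v⌋₊ :=
  (measurable_from_top (f := g)).comp (Nat.measurable_floor.comp (measurable_const_mul (M : ℝ)))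

theorem integral_comp_floor (g : ℕ → ℝ) {M : ℕ} (hM : 0 < M) :
    ∫ v in (0 : ℝ)..1, g ⌊(M : ℝ) * v⌋₊ = (M : ℝ)⁻¹ * ∑ k ∈ Finset.range M, g k := by
  have hM' : (M : ℝ) ≠ 0 := Nat.cast_ne_zero.2 hM.ne'
  have hfl : ∀ k : ℕ, EqOn (fun x : ℝ => g ⌊x⌋₊) (fun _ => g k) (Ico (k : ℝ) (k + 1 : ℕ)) := by
    intro k x hx
    have : ⌊x⌋₊ = k := by
      rw [Nat.floor_eq_iff ((Nat.cast_nonneg k).trans hx.1)]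
      exact ⟨hx.1, by exact_mod_cast hx.2⟩
    simp [this]
  have hle : ∀ k : ℕ, (k : ℝ) ≤ (k + 1 : ℕ) := fun k => Nat.cast_le.2 (Nat.le_succ k)
  have hint : ∀ k : ℕ, IntervalIntegrable (fun x : ℝ => g ⌊x⌋₊) volume (k : ℝ) (k + 1 : ℕ) := by
    intro k
    rw [intervalIntegrable_iff_integrableOn_Ico_of_le (hle k)]
    exact (integrableOn_congr_fun (hfl k) measurableSet_Ico).2 (integrableOn_const (by simp))
  have hk : ∀ k : ℕ, ∫ x in (k : ℝ)..(k + 1 : ℕ), g ⌊x⌋₊ = g k := by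
    intro k
    rw [intervalIntegral.integral_of_le (hle k), ← integral_Ico_eq_integral_Ioc,
      setIntegral_congr_fun measurableSet_Ico (hfl k)]
    simp
  rw [intervalIntegral.integral_comp_mul_left (fun x => g ⌊x⌋₊) hM', mul_zero, mul_one,
    smul_eq_mul]
  congr 1
  have h := intervalIntegral.sum_integral_adjacent_intervals (a := fun k : ℕ => (k : ℝ)) (n := M)
    (f := fun x : ℝ => g ⌊x⌋₊) (μ := volume) fun k _ => hint k
  simp only [Nat.cast_zero] at h
  rw [← h]
  exact Finset.sum_congr rfl fun k _ => hk k

/-- Averages are integrals of step functions, so that they converge by dominated convergence. -/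
theorem tendsto_average {M : ℕ → ℕ} (hM : Tendsto M atTop atTop) {h : ℕ → ℕ → ℝ} {C : ℝ}
    (hC : ∀ n k, |h n k| ≤ C) {G : ℝ → ℝ}
    (hG : ∀ᵐ v : ℝ, v ∈ Ioo (0 : ℝ) 1 →
      Tendsto (fun n => h n ⌊(M n : ℝ) * v⌋₊) atTop (𝓝 (G v))) :
    Tendsto (fun n => (M n : ℝ)⁻¹ * ∑ k ∈ Finset.range (M n), h n k) atTop
      (𝓝 (∫ v in (0 : ℝ)..1, G v)) := by
  have h1 : Tendsto (fun n => ∫ v in (0 : ℝ)..1, h n ⌊(M n : ℝ) * v⌋₊) atTop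
      (𝓝 (∫ v in (0 : ℝ)..1, G v)) := by
    refine intervalIntegral.tendsto_integral_filter_of_dominated_convergence (fun _ => C)
      (Eventually.of_forall fun n => (measurable_comp_floor (h n) (M n)).aestronglyMeasurable)
      (Eventually.of_forall fun n => Eventually.of_forall fun v _ => hC n _)
      intervalIntegrable_const ?_
    have hne : ∀ᵐ v : ℝ, v ≠ 1 := by simp [ae_iff]
    filter_upwards [hG, hne] with v hv hv1 hmem
    rw [uIoc_of_le zero_le_one] at hmem
    exact hv ⟨hmem.1, lt_of_le_of_ne hmem.2 hv1⟩
  refine h1.congr' ?_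
  filter_upwards [hM.eventually_gt_atTop 0] with n hn using integral_comp_floor (h n) hn

/-- The continuous cut-off function equal to `1` on `(-∞, a]` and to `0` on `[b, ∞)` that is affine
in `log x` on `[a, b]`. -/
noncomputable def logCut (a b x : ℝ) : ℝ :=
  (Real.log (max b x) - Real.log (max a x)) / Real.log (b / a)

section LogCut

variable {a b : ℝ} (ha : 0 < a) (hab : a < b)

include ha hab

theorem log_div_pos : 0 < Real.log (b / a) := Real.log_pos ((one_lt_div ha).2 hab)

theorem logCut_of_le {x : ℝ} (hx : x ≤ a) : logCut a b x = 1 := by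
  rw [logCut, max_eq_left hx, max_eq_left (hx.trans hab.le),
    ← Real.log_div (ha.trans hab).ne' ha.ne', div_self (log_div_pos ha hab).ne']

omit ha in
theorem logCut_of_ge {x : ℝ} (hx : b ≤ x) : logCut a b x = 0 := by
  rw [logCut, max_eq_right hx, max_eq_right (hab.le.trans hx), sub_self, zero_div]

theorem logCut_nonneg (x : ℝ) : 0 ≤ logCut a b x :=
  div_nonneg (sub_nonneg.2 (Real.log_le_log (lt_max_of_lt_left ha)
    (max_le_max_right x hab.le))) (log_div_pos ha hab).le

theorem logCut_le_one (x : ℝ) : logCut a b x ≤ 1 := by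
  have hb := ha.trans hab
  rw [logCut, div_le_one (log_div_pos ha hab), Real.log_div hb.ne' ha.ne', sub_le_sub_iff,
    ← Real.log_mul (by positivity) ha.ne', ← Real.log_mul hb.ne' (by positivity)]
  refine Real.log_le_log (by positivity) ?_
  rw [max_mul_of_nonneg _ _ ha.le, mul_max_of_nonneg _ _ hb.le]
  refine max_le (le_max_left _ _) ?_
  rcases le_total 0 x with hx | hx
  · refine le_trans ?_ (le_max_right _ _)
    rw [mul_comm]
    exact mul_le_mul_of_nonneg_right hab.le hx
  · exact (mul_nonpos_of_nonpos_of_nonneg hx ha.le).trans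
      ((mul_pos hb ha).le.trans (le_max_left _ _))

theorem abs_logCut_le_one (x : ℝ) : |logCut a b x| ≤ 1 := by
  rw [abs_of_nonneg (logCut_nonneg ha hab x)]
  exact logCut_le_one ha hab x

theorem continuous_logCut : Continuous (logCut a b) := by
  have h : ∀ c : ℝ, 0 < c → Continuous fun x : ℝ => Real.log (max c x) := fun c hc =>
    (continuous_const.max continuous_id).log fun x => (lt_max_of_lt_left hc).ne'
  exact ((h b (ha.trans hab)).sub (h a ha)).div_const _

end LogCut

theorem integral_logCut_bounds {a b : ℝ} (ha : 0 < a) (hab : a < b) {ξ : ℝ → ℝ}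
    (hξ : MonotoneOn ξ (Ioc 0 1)) {u : ℝ} (hu : u ∈ Ioc (0 : ℝ) 1) :
    (b ≤ ξ u → ∫ v in (0 : ℝ)..1, logCut a b (ξ v) ≤ u) ∧
      (ξ u ≤ a → u ≤ ∫ v in (0 : ℝ)..1, logCut a b (ξ v)) := by
  have hint : IntegrableOn (fun v => logCut a b (ξ v)) (Ioc 0 1) := by
    refine Integrable.of_bound ?_ 1 (Eventually.of_forall fun v => abs_logCut_le_one ha hab _)
    exact ((continuous_logCut ha hab).measurable.comp_aemeasurable
      (aemeasurable_restrict_of_monotoneOn measurableSet_Ioc hξ)).aestronglyMeasurable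
  have hI1 : IntervalIntegrable (fun v => logCut a b (ξ v)) volume 0 u :=
    (intervalIntegrable_iff_integrableOn_Ioc_of_le hu.1.le).2
      (hint.mono_set (Ioc_subset_Ioc_right hu.2))
  have hI2 : IntervalIntegrable (fun v => logCut a b (ξ v)) volume u 1 :=
    (intervalIntegrable_iff_integrableOn_Ioc_of_le hu.2).2
      (hint.mono_set (Ioc_subset_Ioc_left hu.1.le))
  rw [← intervalIntegral.integral_add_adjacent_intervals hI1 hI2]
  constructor
  · intro h
    have e1 : ∫ v in (0 : ℝ)..u, logCut a b (ξ v) ≤ ∫ v in (0 : ℝ)..u, (1 : ℝ) :=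
      intervalIntegral.integral_mono_on hu.1.le hI1 intervalIntegrable_const
        fun v _ => logCut_le_one ha hab _
    have e2 : ∫ v in u..1, logCut a b (ξ v) ≤ ∫ v in u..1, (0 : ℝ) :=
      intervalIntegral.integral_mono_on hu.2 hI2 intervalIntegrable_const
        fun v hv => (logCut_of_ge hab
          (h.trans (hξ hu ⟨hu.1.trans_le hv.1, hv.2⟩ hv.1))).le
    simp only [intervalIntegral.integral_const, smul_eq_mul, mul_one, mul_zero, sub_zero] at e1 e2
    linarith
  · intro h
    have e1 : ∫ v in (0 : ℝ)..u, (1 : ℝ) ≤ ∫ v in (0 : ℝ)..u, logCut a b (ξ v) := by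
      refine intervalIntegral.integral_mono_on_of_le_Ioo hu.1.le intervalIntegrable_const hI1
        fun v hv => ?_
      rw [logCut_of_le ha hab ((hξ ⟨hv.1, hv.2.le.trans hu.2⟩ hu hv.2.le).trans h)]
    have e2 : 0 ≤ ∫ v in u..1, logCut a b (ξ v) :=
      intervalIntegral.integral_nonneg hu.2 fun v _ => logCut_nonneg ha hab _
    simp only [intervalIntegral.integral_const, smul_eq_mul, mul_one, sub_zero] at e1
    linarith

/-- Let `s_n` be nondecreasing families of `n` nonnegative numbers whose empirical measures converge
to the law of `ξ` under the uniform distribution, tested against the cut-off functions `logCut`.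
Then the `⌊n v⌋`-th member of `s_n` converges to `ξ(v)` at each continuity point `v` of `ξ`. -/
theorem tendsto_floor_of_continuousAt {s : ℕ → ℕ → ℝ} (hs0 : ∀ n k, 0 ≤ s n k)
    (hs : ∀ n i j, i ≤ j → j < n → s n i ≤ s n j) {ξ : ℝ → ℝ} (hξ : MonotoneOn ξ (Ioc 0 1))
    (hξ0 : ∀ v ∈ Ioc (0 : ℝ) 1, 0 ≤ ξ v)
    (H : ∀ a b : ℝ, 0 < a → a < b →
      Tendsto (fun n : ℕ => (n : ℝ)⁻¹ * ∑ k ∈ Finset.range n, logCut a b (s n k)) atTop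
        (𝓝 (∫ v in (0 : ℝ)..1, logCut a b (ξ v))))
    {v : ℝ} (hv : v ∈ Ioo (0 : ℝ) 1) (hcont : ContinuousAt ξ v) :
    Tendsto (fun n : ℕ => s n ⌊(n : ℝ) * v⌋₊) atTop (𝓝 (ξ v)) := by
  have hfloor : ∀ n : ℕ, 0 < n → ⌊(n : ℝ) * v⌋₊ < n := fun n hn => by
    have hn' : (0 : ℝ) < n := Nat.cast_pos.2 hn
    rw [Nat.floor_lt (mul_nonneg hn'.le hv.1.le)]
    exact (mul_lt_iff_lt_one_right hn').2 hv.2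
  refine tendsto_order.2 ⟨fun a' ha' => ?_, fun b' hb' => ?_⟩
  · rcases lt_or_ge a' 0 with h0 | h0
    · exact Eventually.of_forall fun n => h0.trans_le (hs0 n _)
    obtain ⟨a, haa, haξ⟩ := exists_between ha'
    obtain ⟨b, hab, hbξ⟩ := exists_between haξ
    have ha : 0 < a := h0.trans_lt haa
    have e1 : ∀ᶠ u in 𝓝[<] v, b < ξ u :=
      (hcont.tendsto.mono_left nhdsWithin_le_nhds).eventually_const_lt hbξ
    have e2 : ∀ᶠ u in 𝓝[<] v, u ∈ Ioo 0 v := Ioo_mem_nhdsLT hv.1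
    obtain ⟨u, hbu, hu⟩ := (e1.and e2).exists
    have hI := (integral_logCut_bounds ha hab hξ ⟨hu.1, hu.2.le.trans hv.2.le⟩).1 hbu.le
    filter_upwards [(H a b ha hab).eventually_lt_const (hI.trans_lt hu.2),
      eventually_gt_atTop 0] with n hn hn0
    have hn' : (0 : ℝ) < n := Nat.cast_pos.2 hn0
    by_contra! hle
    -- the first `⌊n v⌋ + 1` summands equal `1`
    have h1 : ((⌊(n : ℝ) * v⌋₊ + 1 : ℕ) : ℝ) ≤ ∑ k ∈ Finset.range n, logCut a b (s n k) := by
      calc ((⌊(n : ℝ) * v⌋₊ + 1 : ℕ) : ℝ)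
          = ∑ k ∈ Finset.range (⌊(n : ℝ) * v⌋₊ + 1), logCut a b (s n k) := by
            rw [Finset.sum_congr rfl fun k hk => logCut_of_le ha hab
              ((hs n k _ (Nat.lt_succ_iff.1 (Finset.mem_range.1 hk)) (hfloor n hn0)).trans
                (hle.trans haa.le))]
            simp
        _ ≤ _ := Finset.sum_le_sum_of_subset_of_nonneg
            (Finset.range_subset_range.2 (hfloor n hn0)) fun k _ _ => logCut_nonneg ha hab _
    rw [inv_mul_lt_iff₀ hn'] at hn
    have h2 := Nat.lt_floor_add_one ((n : ℝ) * v)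
    push_cast at h1
    linarith
  · have hb0 : 0 ≤ ξ v := hξ0 v (Ioo_subset_Ioc_self hv)
    obtain ⟨b, hbξ, hbb⟩ := exists_between hb'
    obtain ⟨a, haξ, hab⟩ := exists_between hbξ
    have ha : 0 < a := hb0.trans_lt haξ
    have e1 : ∀ᶠ u in 𝓝[>] v, ξ u < a :=
      (hcont.tendsto.mono_left nhdsWithin_le_nhds).eventually_lt_const haξ
    have e2 : ∀ᶠ u in 𝓝[>] v, u ∈ Ioo v 1 := Ioo_mem_nhdsGT hv.2
    obtain ⟨u, hbu, hu⟩ := (e1.and e2).exists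
    have hI := (integral_logCut_bounds ha hab hξ ⟨hv.1.trans hu.1, hu.2.le⟩).2 hbu.le
    filter_upwards [(H a b ha hab).eventually_const_lt (hu.1.trans_le hI),
      eventually_gt_atTop 0] with n hn hn0
    have hn' : (0 : ℝ) < n := Nat.cast_pos.2 hn0
    by_contra! hle
    -- all but the first `⌊n v⌋` summands vanish
    have h1 : ∑ k ∈ Finset.range n, logCut a b (s n k) ≤ (⌊(n : ℝ) * v⌋₊ : ℝ) := by
      rw [← Finset.sum_range_add_sum_Ico _ (hfloor n hn0).le,
        Finset.sum_eq_zero (s := Finset.Ico _ n) fun k hk => ?_, add_zero]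
      · calc _ ≤ ∑ k ∈ Finset.range ⌊(n : ℝ) * v⌋₊, (1 : ℝ) :=
              Finset.sum_le_sum fun k _ => logCut_le_one ha hab _
          _ = _ := by simp
      · obtain ⟨hk1, hk2⟩ := Finset.mem_Ico.1 hk
        exact logCut_of_ge hab (hbb.le.trans (hle.trans (hs n _ k hk1 hk2)))
    rw [lt_inv_mul_iff₀ hn'] at hn
    have h2 := Nat.floor_le (mul_nonneg hn'.le hv.1.le)
    linarith

theorem ae_continuousAt_of_monotoneOn {ξ : ℝ → ℝ} (hξ : MonotoneOn ξ (Ioc 0 1)) :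
    ∀ᵐ v : ℝ, v ∈ Ioo (0 : ℝ) 1 → ContinuousAt ξ v := by
  have hc := (hξ.mono Ioo_subset_Ioc_self).countable_not_continuousWithinAt
  filter_upwards [hc.ae_notMem volume] with v hv hmem
  by_contra hcon
  exact hv ⟨hmem, fun h => hcon (h.continuousAt (Ioo_mem_nhds hmem.1 hmem.2))⟩

theorem integral_empirical {E : Type*} [TopologicalSpace E] [MeasurableSpace E]
    [OpensMeasurableSpace E] (s : Multiset E) (f : BoundedContinuousFunction E ℝ) :
    ∫ x, f x ∂(empirical s : Measure E) = (s.card : ℝ)⁻¹ * (s.map f).sum := by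
  have h : ∫ x, f x ∂((s.map fun x => toFin (Measure.dirac x)).sum : FiniteMeasure E) =
      (s.map f).sum := by
    induction s using Multiset.induction_on with
    | empty => simp
    | cons a s ih =>
      rw [Multiset.map_cons, Multiset.sum_cons, FiniteMeasure.toMeasure_add,
        integral_add_measure (f.integrable _) (f.integrable _), ih, Multiset.map_cons,
        Multiset.sum_cons]
      congr 1
      exact integral_dirac' f a f.continuous.stronglyMeasurable
  rw [empirical, FiniteMeasure.toMeasure_smul, integral_smul_nnreal_measure, h]
  simp [NNReal.smul_def]

/-! ### Roots of polynomials in `z ^ m` -/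

theorem exists_sorted_enumeration (s : Multiset ℂ) :
    ∃ w : ℕ → ℂ, s = (Multiset.range s.card).map w ∧
      ∀ i j, i ≤ j → j < s.card → ‖w i‖ ≤ ‖w j‖ := by
  let l := s.toList.mergeSort fun a b => decide (‖a‖ ≤ ‖b‖)
  have hl : (l : Multiset ℂ) = s := by
    rw [← Multiset.coe_toList s]
    exact Multiset.coe_eq_coe.2 (List.mergeSort_perm _ _)
  have hlen : s.card = l.length := by
    rw [← hl, Multiset.coe_card]
  have hsort : l.Pairwise fun a b => ‖a‖ ≤ ‖b‖ := by
    have h := List.pairwise_mergeSort (le := fun a b : ℂ => decide (‖a‖ ≤ ‖b‖))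
      (fun a b c hab hbc => by simp only [decide_eq_true_eq] at *; exact hab.trans hbc)
      (fun a b => by simpa using le_total ‖a‖ ‖b‖) s.toList
    simpa using h
  refine ⟨fun k => l.getD k 0, ?_, fun i j hij hj => ?_⟩
  · rw [hlen, ← Multiset.coe_range, Multiset.map_coe]
    conv_lhs => rw [← hl]
    congr 1
    refine List.ext_getElem (by simp) fun k h1 h2 => ?_
    simp [h1]
  · rw [hlen] at hj
    rcases hij.eq_or_lt with rfl | hlt
    · exact le_rfl
    · simp only [List.getD_eq_getElem _ _ hj, List.getD_eq_getElem _ _ (hij.trans_lt hj)]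
      exact List.pairwise_iff_getElem.1 hsort i j _ _ hlt

theorem roots_expand_eq_bind (T : ℂ[X]) {m : ℕ} (hm : 0 < m) :
    (expand ℂ m T).roots = T.roots.bind fun w => nthRoots m w := by
  rcases eq_or_ne T 0 with rfl | hT
  · simp
  have h := (IsAlgClosed.splits T).eq_prod_roots
  have hC : T.leadingCoeff ≠ 0 := leadingCoeff_ne_zero.2 hT
  conv_lhs => rw [h]
  rw [map_mul, expand_C, roots_C_mul _ hC, map_multiset_prod, Multiset.map_map,
    roots_multiset_prod, Multiset.bind_map]
  · refine Multiset.bind_congr fun w _ => ?_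
    simp [nthRoots]
  · simp only [Multiset.mem_map, not_exists, not_and, Function.comp_apply]
    intro w _
    rw [map_sub, expand_X, expand_C]
    exact X_pow_sub_C_ne_zero hm w

theorem sum_nthRoots (F : ℂ → ℝ) (w : ℂ) {m : ℕ} (hm : 0 < m) :
    ((nthRoots m w).map F).sum =
      ∑ j ∈ Finset.range m, F (((‖w‖ ^ (m : ℝ)⁻¹ : ℝ) : ℂ) *
        Complex.exp ((w.arg / m + 2 * Real.pi * (j / m) : ℝ) * Complex.I)) := by
  have hm' : (m : ℂ) ≠ 0 := Nat.cast_ne_zero.2 hm.ne'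
  set α : ℂ := ((‖w‖ ^ (m : ℝ)⁻¹ : ℝ) : ℂ) * Complex.exp ((w.arg / m : ℝ) * Complex.I) with hα
  have hpow : α ^ m = w := by
    rw [hα, mul_pow, ← Complex.ofReal_pow, Real.rpow_inv_natCast_pow (norm_nonneg w) hm.ne',
      ← Complex.exp_nat_mul]
    have : (m : ℂ) * ((w.arg / m : ℝ) * Complex.I) = w.arg * Complex.I := by
      push_cast
      field_simp
    rw [this, Complex.norm_mul_exp_arg_mul_I]
  rw [(Complex.isPrimitiveRoot_exp m hm.ne').nthRoots_eq hpow, Multiset.map_map]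
  change ∑ j ∈ Finset.range m, F (_ * α) = _
  refine Finset.sum_congr rfl fun j _ => ?_
  congr 1
  rw [hα, ← Complex.exp_nat_mul, mul_left_comm, ← Complex.exp_add]
  congr 2
  push_cast
  field_simp
  ring

/-- Summation over the roots of the `N`-th derivative of `p(z ^ m)`. -/
theorem sum_roots_iterate_derivative (F : ℂ → ℝ) {p : ℂ[X]} {m N : ℕ} (hm : 0 < m)
    (hT : fallingWeight p m N ≠ 0) :
    ((derivative^[N] (expand ℂ m p)).roots.map F).sum =
      ((fallingWeight p m N).roots.map fun w => ((nthRoots m w).map F).sum).sum - N * F 0 := by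
  have h := X_pow_mul_iterate_derivative_expand p hm N
  have hne : X ^ N * derivative^[N] (expand ℂ m p) ≠ 0 := by
    rw [h]
    exact (expand_ne_zero hm).2 hT
  have hr := congrArg roots h
  rw [roots_mul hne, roots_X_pow, roots_expand_eq_bind _ hm] at hr
  have hs := congrArg (fun s => (Multiset.map F s).sum) hr
  simp only [Multiset.map_add, Multiset.sum_add, Multiset.map_bind, Multiset.sum_bind,
    Multiset.map_nsmul, Multiset.sum_nsmul, Multiset.map_singleton, Multiset.sum_singleton,
    nsmul_eq_mul] at hs
  linarith

/-! ### Limits of the weights -/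

theorem tendsto_floor_mul_div {u : ℕ → ℝ} (hu : Tendsto u atTop atTop) {c : ℝ} (hc : 0 ≤ c) :
    Tendsto (fun n => (⌊u n * c⌋₊ : ℝ) / u n) atTop (𝓝 c) := by
  refine ((tendsto_nat_floor_mul_div_atTop hc).comp hu).congr fun n => ?_
  simp [mul_comm]

theorem tendsto_weightRatio {m : ℕ → ℕ} (hm : Tendsto m atTop atTop) {t v : ℝ}
    (ht : 0 < t) (hv : 0 < v) (hvt : v ≠ t) :
    Tendsto (fun n : ℕ => weightRatio (m n) ⌊(n : ℝ) * (m n : ℝ) * t⌋₊ ⌊(n : ℝ) * v⌋₊ ^ (m n : ℝ)⁻¹)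
      atTop (𝓝 (max 0 (1 - t / v))) := by
  have hn : Tendsto (fun n : ℕ => (n : ℝ)) atTop atTop := tendsto_natCast_atTop_atTop
  have hm' : Tendsto (fun n : ℕ => (m n : ℝ)) atTop atTop := hn.comp hm
  have hA := tendsto_floor_mul_div (hn.atTop_mul_atTop₀ hm') ht.le
  have hB := tendsto_floor_mul_div hn hv.le
  set N : ℕ → ℕ := fun n => ⌊(n : ℝ) * (m n : ℝ) * t⌋₊ with hN
  set k : ℕ → ℕ := fun n => ⌊(n : ℝ) * v⌋₊ with hk
  have hB' : Tendsto (fun n : ℕ => ((k n + 1 : ℕ) : ℝ) / n) atTop (𝓝 v) := by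
    have := hB.add tendsto_inv_atTop_nhds_zero_nat
    rw [add_zero] at this
    refine this.congr fun n => ?_
    push_cast
    rw [add_div, one_div]
  have hdiv : ∀ {l : ℕ → ℕ}, Tendsto (fun n : ℕ => (l n : ℝ) / n) atTop (𝓝 v) →
      Tendsto (fun n => 1 - (N n : ℝ) / (m n * l n : ℕ)) atTop (𝓝 (1 - t / v)) := by
    intro l hl
    refine tendsto_const_nhds.sub ((hA.div hl hv.ne').congr' ?_)
    filter_upwards [hn.eventually_gt_atTop 0, hm'.eventually_gt_atTop 0] with n h1 h2
    push_cast
    simp only [Pi.div_apply]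
    field_simp
    rfl
  have hcmp : ∀ n : ℕ, (0 : ℝ) < n → (0 : ℝ) < m n →
      ((N n : ℝ) / ((n : ℝ) * m n) < (k n : ℝ) / n ↔ N n < m n * k n) ∧
      ((k n : ℝ) / n < (N n : ℝ) / ((n : ℝ) * m n) ↔ m n * k n < N n) := by
    intro n h1 h2
    have h3 : (k n : ℝ) / n = (m n * k n : ℕ) / ((n : ℝ) * m n) := by
      push_cast
      field_simp
    rw [h3, div_lt_div_iff_of_pos_right (mul_pos h1 h2),
      div_lt_div_iff_of_pos_right (mul_pos h1 h2), Nat.cast_lt, Nat.cast_lt]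
    exact ⟨Iff.rfl, Iff.rfl⟩
  rcases lt_or_gt_of_ne hvt with hlt | hgt
  · have h1 : max 0 (1 - t / v) = 0 := max_eq_left (sub_nonpos.2 ((one_le_div hv).2 hlt.le))
    rw [h1]
    refine tendsto_const_nhds.congr' ?_
    filter_upwards [hB.eventually_lt hA hlt, hn.eventually_gt_atTop 0, hm'.eventually_gt_atTop 0]
      with n h2 h3 h4
    rw [weightRatio_eq_zero ((hcmp n h3 h4).2.1 h2), Real.zero_rpow (inv_ne_zero h4.ne')]
  · have h1 : max 0 (1 - t / v) = 1 - t / v :=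
      max_eq_right (sub_nonneg.2 ((div_le_one hv).2 hgt.le))
    rw [h1]
    refine tendsto_of_tendsto_of_tendsto_of_le_of_le' (hdiv hB) (hdiv hB') ?_ ?_
    · filter_upwards [hA.eventually_lt hB hgt, hn.eventually_gt_atTop 0, hm'.eventually_gt_atTop 0]
        with n h2 h3 h4
      have h5 := ((hcmp n h3 h4).1.1 h2).le
      have h6 : m n ≠ 0 := Nat.cast_ne_zero.1 h4.ne'
      have h7 := Real.rpow_le_rpow (pow_nonneg (one_sub_div_cast_nonneg h5) _)
        (pow_le_weightRatio h5) (inv_nonneg.2 h4.le)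
      rwa [Real.pow_rpow_inv_natCast (one_sub_div_cast_nonneg h5) h6] at h7
    · filter_upwards [hA.eventually_lt hB hgt, hn.eventually_gt_atTop 0, hm'.eventually_gt_atTop 0]
        with n h2 h3 h4
      have h5 := ((hcmp n h3 h4).1.1 h2).le
      have h6 : m n ≠ 0 := Nat.cast_ne_zero.1 h4.ne'
      have h7 := Real.rpow_le_rpow (weightRatio_nonneg _ _ _)
        (weightRatio_le_pow h5) (inv_nonneg.2 h4.le)
      rwa [Real.pow_rpow_inv_natCast (one_sub_div_cast_nonneg (h5.trans
        (Nat.mul_le_mul_left _ (Nat.le_succ _)))) h6] at h7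

/-! ### Comparison of cut-off averages -/

/-- If `∏ max R x_j` and `∏ max R y_j` agree up to a factor `2 ^ (n / m)` for all `R`, then the
averages of `logCut` over `x` and `y` agree up to `O(1 / m)`. -/
theorem abs_average_logCut_sub_le {x y : ℕ → ℝ} {n m : ℕ} (hn : 0 < n) (hm : 0 < m)
    (hxy : ∀ R : ℝ, 0 < R →
      ∏ j ∈ Finset.range n, max R (x j) ^ m ≤ 2 ^ n * ∏ j ∈ Finset.range n, max R (y j) ^ m)
    (hyx : ∀ R : ℝ, 0 < R →
      ∏ j ∈ Finset.range n, max R (y j) ^ m ≤ 2 ^ n * ∏ j ∈ Finset.range n, max R (x j) ^ m)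
    {a b : ℝ} (ha : 0 < a) (hab : a < b) :
    |(n : ℝ)⁻¹ * ∑ j ∈ Finset.range n, logCut a b (y j) -
      (n : ℝ)⁻¹ * ∑ j ∈ Finset.range n, logCut a b (x j)| ≤
      2 * Real.log 2 / Real.log (b / a) * (m : ℝ)⁻¹ := by
  have hn' : (0 : ℝ) < n := Nat.cast_pos.2 hn
  have hm' : (0 : ℝ) < m := Nat.cast_pos.2 hm
  have key : ∀ x y : ℕ → ℝ, ∀ R : ℝ, 0 < R →
      ∏ j ∈ Finset.range n, max R (x j) ^ m ≤ 2 ^ n * ∏ j ∈ Finset.range n, max R (y j) ^ m →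
      ∑ j ∈ Finset.range n, Real.log (max R (x j)) ≤
        n * Real.log 2 * (m : ℝ)⁻¹ + ∑ j ∈ Finset.range n, Real.log (max R (y j)) := by
    intro x y R hR h
    have hpos : ∀ z : ℕ → ℝ, ∀ j, 0 < max R (z j) := fun z j => lt_max_of_lt_left hR
    have h1 := Real.log_le_log (Finset.prod_pos fun j _ => pow_pos (hpos x j) m) h
    rw [Real.log_mul (by positivity) (Finset.prod_pos fun j _ => pow_pos (hpos y j) m).ne',
      Real.log_prod fun j _ => (pow_pos (hpos x j) m).ne',
      Real.log_prod fun j _ => (pow_pos (hpos y j) m).ne', Real.log_pow] at h1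
    simp only [Real.log_pow, ← Finset.mul_sum] at h1
    rw [← sub_nonneg] at h1 ⊢
    have h2 := mul_nonneg h1 (inv_nonneg.2 hm'.le)
    refine h2.trans (le_of_eq ?_)
    field_simp
  have hb := ha.trans hab
  have hl := log_div_pos ha hab
  have e1 := key x y a ha (hxy a ha)
  have e2 := key x y b hb (hxy b hb)
  have e3 := key y x a ha (hyx a ha)
  have e4 := key y x b hb (hyx b hb)
  simp only [logCut, ← Finset.sum_div, Finset.sum_sub_distrib]
  generalize ∑ j ∈ Finset.range n, Real.log (max a (x j)) = xa at *
  generalize ∑ j ∈ Finset.range n, Real.log (max b (x j)) = xb at *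
  generalize ∑ j ∈ Finset.range n, Real.log (max a (y j)) = ya at *
  generalize ∑ j ∈ Finset.range n, Real.log (max b (y j)) = yb at *
  have h3 : (n : ℝ)⁻¹ * ((yb - ya) / Real.log (b / a)) - (n : ℝ)⁻¹ * ((xb - xa) / Real.log (b / a)) =
      ((yb - ya) - (xb - xa)) / (n * Real.log (b / a)) := by
    field_simp
  rw [h3, abs_div, abs_of_pos (mul_pos hn' hl), div_le_iff₀ (mul_pos hn' hl), abs_le]
  have h4 : 2 * Real.log 2 / Real.log (b / a) * (m : ℝ)⁻¹ * (n * Real.log (b / a)) =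
      2 * (n * Real.log 2 * (m : ℝ)⁻¹) := by
    field_simp
  rw [h4]
  constructor <;> linarith

/-! ### Rotation averages -/

/-- The average of `F` over the circle of radius `ρ`. -/
noncomputable def circleMean (F : ℂ → ℝ) (ρ : ℝ) : ℝ :=
  ∫ u in (0 : ℝ)..1, F ((ρ : ℂ) * Complex.exp ((2 * Real.pi * u : ℝ) * Complex.I))

theorem circleMean_zero (F : ℂ → ℝ) : circleMean F 0 = F 0 := by
  simp [circleMean]

theorem continuous_circleMean {F : ℂ → ℝ} (hF : Continuous F) : Continuous (circleMean F) := by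
  refine intervalIntegral.continuous_parametric_intervalIntegral_of_continuous' ?_ 0 1
  exact hF.comp (by fun_prop)

theorem abs_circleMean_le {F : ℂ → ℝ} {C : ℝ} (hC : ∀ z, |F z| ≤ C) (ρ : ℝ) :
    |circleMean F ρ| ≤ C := by
  have h := intervalIntegral.norm_integral_le_of_norm_le_const (a := (0 : ℝ)) (b := 1)
    (f := fun u => F ((ρ : ℂ) * Complex.exp ((2 * Real.pi * u : ℝ) * Complex.I))) (C := C)
    fun u _ => hC _
  simpa [circleMean] using h

/-- Averages over `M_n` equally spaced points on circles whose radii converge to `ρ`. -/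
theorem tendsto_average_circle {F : ℂ → ℝ} (hF : Continuous F) {C : ℝ} (hC : ∀ z, |F z| ≤ C)
    {M : ℕ → ℕ} (hM : Tendsto M atTop atTop) {y φ : ℕ → ℝ} {ρ : ℝ} (hy : Tendsto y atTop (𝓝 ρ))
    (hφ : Tendsto φ atTop (𝓝 0)) :
    Tendsto (fun n => (M n : ℝ)⁻¹ * ∑ j ∈ Finset.range (M n), F ((y n : ℂ) *
      Complex.exp ((φ n + 2 * Real.pi * (j / M n) : ℝ) * Complex.I))) atTop
      (𝓝 (circleMean F ρ)) := by
  refine tendsto_average hM (h := fun n j => F ((y n : ℂ) *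
    Complex.exp ((φ n + 2 * Real.pi * (j / M n) : ℝ) * Complex.I))) (fun n k => hC _)
    (Eventually.of_forall fun u hu => ?_)
  have h1 : Tendsto (fun n => (⌊(M n : ℝ) * u⌋₊ : ℝ) / M n) atTop (𝓝 u) :=
    tendsto_floor_mul_div (tendsto_natCast_atTop_atTop.comp hM) hu.1.le
  have h2 : Tendsto (fun n => φ n + 2 * Real.pi * ((⌊(M n : ℝ) * u⌋₊ : ℝ) / M n)) atTop
      (𝓝 (2 * Real.pi * u)) := by
    simpa using hφ.add (h1.const_mul (2 * Real.pi))
  have hcont : Continuous fun p : ℝ × ℝ =>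
      F ((p.1 : ℂ) * Complex.exp ((p.2 : ℂ) * Complex.I)) := hF.comp (by fun_prop)
  exact (hcont.tendsto (ρ, 2 * Real.pi * u)).comp (hy.prodMk_nhds h2)

theorem integral_rotInv (ν : Measure ℝ) [IsFiniteMeasure ν] (F : BoundedContinuousFunction ℂ ℝ) :
    ∫ z, F z ∂(rotInv ν) = ∫ ρ, circleMean F ρ ∂ν := by
  have hcont : Continuous fun p : ℝ × ℝ => (p.1 : ℂ) * Complex.exp (p.2 * Complex.I) := by
    fun_prop
  have hint : Integrable (fun p : ℝ × ℝ => F ((p.1 : ℂ) * Complex.exp (p.2 * Complex.I)))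
      (ν.prod (unifOn (Ico 0 (2 * Real.pi)))) :=
    (F.compContinuous ⟨_, hcont⟩).integrable _
  rw [rotInv, integral_map hcont.aemeasurable F.continuous.aestronglyMeasurable,
    integral_prod _ hint]
  congr 1
  ext ρ
  have hpi : (0 : ℝ) < 2 * Real.pi := Real.two_pi_pos
  rw [unifOn, ProbabilityTheory.cond, integral_smul_measure, integral_Ico_eq_integral_Ioc,
    ← intervalIntegral.integral_of_le hpi.le, Real.volume_Ico, sub_zero, ENNReal.toReal_inv,
    ENNReal.toReal_ofReal hpi.le, circleMean,
    intervalIntegral.integral_comp_mul_left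
      (fun u : ℝ => F ((ρ : ℂ) * Complex.exp ((u : ℝ) * Complex.I))) hpi.ne', mul_zero, mul_one]

/-! ### Convergence of the root measures -/

/-- The limiting radius `(1 - t / v)⁺ q(v)` of the `⌊n v⌋`-th smallest of the `n` circles that carry
the roots, where the root `0` counts as circles of radius `0`. -/
noncomputable def rootRadius (ν : Measure ℝ) (t v : ℝ) : ℝ := max 0 (1 - t / v) * quantile ν v

theorem rootRadius_nonneg (ν : Measure ℝ) (t v : ℝ) : 0 ≤ rootRadius ν t v :=
  mul_nonneg (le_max_left _ _) (quantile_nonneg ν v)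

theorem rootRadius_of_le (ν : Measure ℝ) {t v : ℝ} (hv : 0 < v) (h : v ≤ t) :
    rootRadius ν t v = 0 := by
  rw [rootRadius, max_eq_left (sub_nonpos.2 ((one_le_div hv).2 h)), zero_mul]

theorem rootRadius_of_ge (ν : Measure ℝ) {t v : ℝ} (ht : 0 ≤ t) (h : t ≤ v) :
    rootRadius ν t v = flowRadius ν t v := by
  rw [rootRadius, max_eq_right (one_sub_div_nonneg ht h), flowRadius]

section Convergence

variable {ν₀ : Measure ℝ} [IsProbabilityMeasure ν₀] (hsupp : ∃ R : ℝ, ν₀ (Icc 0 R)ᶜ = 0)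

include hsupp

theorem rootRadius_monotoneOn {t : ℝ} (ht : 0 ≤ t) :
    MonotoneOn (rootRadius ν₀ t) (Ioc 0 1) := by
  intro u hu v hv huv
  refine mul_le_mul (max_le_max_left 0 ?_) (quantile_monotoneOn hsupp hu.2 hv.2 huv)
    (quantile_nonneg _ _) (le_max_left _ _)
  exact sub_le_sub_left (div_le_div_of_nonneg_left ht hu.1 huv) 1

theorem integral_eq_integral_quantile {f : ℝ → ℝ} (hf : Continuous f) :
    ∫ x, f x ∂ν₀ = ∫ v in (0 : ℝ)..1, f (quantile ν₀ v) := by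
  conv_lhs => rw [← map_quantile hsupp]
  rw [integral_map (aemeasurable_restrict_of_monotoneOn measurableSet_Icc
      ((quantile_monotoneOn hsupp).mono fun x hx => hx.2)) hf.aestronglyMeasurable,
    integral_Icc_eq_integral_Ioc, intervalIntegral.integral_of_le zero_le_one]

/-- Order statistics of samples that converge weakly to `ν₀` converge to the quantiles. -/
theorem tendsto_orderStatistic {r : (n : ℕ) → Fin n → ℝ} {r' : ℕ → ℕ → ℝ}
    (hr' : ∀ n, Monotone (r' n)) (hr0 : ∀ n k, 0 ≤ r' n k)
    (heq : ∀ n, ∀ i : Fin n, r' n i = r n i)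
    (hlim : Tendsto (fun n => empirical (Finset.univ.val.map (r n))) atTop (𝓝 (toFin ν₀))) :
    ∀ᵐ v : ℝ, v ∈ Ioo (0 : ℝ) 1 →
      Tendsto (fun n : ℕ => r' n ⌊(n : ℝ) * v⌋₊) atTop (𝓝 (quantile ν₀ v)) := by
  have hq : MonotoneOn (quantile ν₀) (Ioc 0 1) :=
    (quantile_monotoneOn hsupp).mono fun x hx => hx.2
  filter_upwards [ae_continuousAt_of_monotoneOn hq] with v hv hmem
  refine tendsto_floor_of_continuousAt hr0 (fun n i j hij _ => hr' n hij) hq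
    (fun v _ => quantile_nonneg _ _) (fun a b ha hab => ?_) hmem (hv hmem)
  let g : BoundedContinuousFunction ℝ ℝ := BoundedContinuousFunction.ofNormedAddCommGroup
    (logCut a b) (continuous_logCut ha hab) 1 (abs_logCut_le_one ha hab)
  have h := FiniteMeasure.tendsto_iff_forall_integral_tendsto.1 hlim g
  have h2 : ∫ x, g x ∂((toFin ν₀ : FiniteMeasure ℝ) : Measure ℝ) =
      ∫ v in (0 : ℝ)..1, logCut a b (quantile ν₀ v) :=
    integral_eq_integral_quantile hsupp (continuous_logCut ha hab)
  rw [h2] at h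
  refine h.congr fun n => ?_
  rw [integral_empirical, Multiset.map_map, Multiset.card_map, Finset.card_val, Finset.card_univ,
    Fintype.card_fin, Finset.sum_range]
  congr 1
  change ∑ i : Fin n, logCut a b (r n i) = _
  exact Finset.sum_congr rfl fun i _ => by rw [heq]

theorem integral_rotInv_radialFlow {t : ℝ} (ht : t ∈ Ioo (0 : ℝ) 1)
    (F : BoundedContinuousFunction ℂ ℝ) :
    ∫ z, F z ∂(rotInv (radialFlow ν₀ t)) =
      (1 - t)⁻¹ * ((∫ v in (0 : ℝ)..1, circleMean F (rootRadius ν₀ t v)) - t * F 0) := by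
  have hF := continuous_circleMean F.continuous
  have hC : ∀ ρ, |circleMean F ρ| ≤ ‖F‖ := abs_circleMean_le fun z => F.norm_coe_le_norm z
  rw [integral_rotInv, radialFlow_eq, integral_smul_measure,
    integral_map (aemeasurable_flowRadius hsupp ht.1.le) hF.aestronglyMeasurable,
    ENNReal.toReal_inv, ENNReal.toReal_ofReal (sub_nonneg.2 ht.2.le), smul_eq_mul,
    integral_Icc_eq_integral_Ioc, ← intervalIntegral.integral_of_le ht.2.le]
  congr 1
  have hint : IntegrableOn (fun v => circleMean F (rootRadius ν₀ t v)) (Ioc 0 1) := by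
    refine Integrable.of_bound ?_ ‖F‖ (Eventually.of_forall fun v => hC _)
    exact (hF.measurable.comp_aemeasurable (aemeasurable_restrict_of_monotoneOn measurableSet_Ioc
      (rootRadius_monotoneOn hsupp ht.1.le))).aestronglyMeasurable
  rw [← intervalIntegral.integral_add_adjacent_intervals (b := t)
    ((intervalIntegrable_iff_integrableOn_Ioc_of_le ht.1.le).2
      (hint.mono_set (Ioc_subset_Ioc_right ht.2.le)))
    ((intervalIntegrable_iff_integrableOn_Ioc_of_le ht.2.le).2
      (hint.mono_set (Ioc_subset_Ioc_left ht.1.le)))]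
  have h1 : ∫ v in (0 : ℝ)..t, circleMean F (rootRadius ν₀ t v) = t * F 0 := by
    have : ∫ v in (0 : ℝ)..t, circleMean F (rootRadius ν₀ t v) = ∫ v in (0 : ℝ)..t, F 0 := by
      rw [intervalIntegral.integral_of_le ht.1.le, intervalIntegral.integral_of_le ht.1.le]
      refine setIntegral_congr_fun measurableSet_Ioc fun v hv => ?_
      rw [rootRadius_of_le ν₀ hv.1 hv.2, circleMean_zero]
    rw [this]
    simp
  rw [h1, add_sub_cancel_left]
  refine intervalIntegral.integral_congr fun v hv => ?_
  rw [uIcc_of_le ht.2.le] at hv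
  rw [rootRadius_of_ge ν₀ ht.1.le hv.1]

omit hsupp in
theorem exists_monotone_extension {n : ℕ} {r : Fin n → ℝ} (hr : Monotone r) (h0 : ∀ j, 0 ≤ r j) :
    ∃ r' : ℕ → ℝ, Monotone r' ∧ (∀ k, 0 ≤ r' k) ∧ ∀ i : Fin n, r' i = r i := by
  rcases n with _ | n
  · exact ⟨fun _ => 0, monotone_const, fun _ => le_rfl, fun i => i.elim0⟩
  · refine ⟨fun k => r ⟨min k n, by omega⟩, fun i j hij => hr ?_, fun k => h0 _, fun i => ?_⟩
    · exact Fin.mk_le_mk.2 (min_le_min_right n hij)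
    · simp only [min_eq_left (Nat.lt_succ_iff.1 i.2)]

theorem tendsto_empirical_roots {r : (n : ℕ) → Fin n → ℝ} (hr : ∀ n, Monotone (r n))
    (hr0 : ∀ n j, 0 ≤ r n j)
    (hlim : Tendsto (fun n => empirical (Finset.univ.val.map (r n))) atTop (𝓝 (toFin ν₀)))
    {m : ℕ → ℕ} (hm : Tendsto m atTop atTop) {t : ℝ} (ht : t ∈ Ioo (0 : ℝ) 1) :
    Tendsto (fun n : ℕ =>
        empirical (derivative^[⌊(n : ℝ) * (m n : ℝ) * t⌋₊] (samplePoly (r n) (m n))).roots)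
      atTop (𝓝 (toFin (rotInv (radialFlow ν₀ t)))) := by
  choose r' hmono hnonneg hext using fun n => exists_monotone_extension (hr n) (hr0 n)
  set N : ℕ → ℕ := fun n => ⌊(n : ℝ) * (m n : ℝ) * t⌋₊ with hN_def
  have hN : ∀ n, N n ≤ m n * n := fun n => by
    refine Nat.floor_le_of_le ?_
    push_cast
    rw [mul_comm (m n : ℝ)]
    exact mul_le_of_le_one_right (by positivity) ht.2.le
  let p : ℕ → ℂ[X] := fun n => ∏ j ∈ Finset.range n, (X - C ((r' n j ^ m n : ℝ) : ℂ))
  have hp : ∀ n, samplePoly (r n) (m n) = expand ℂ (m n) (p n) := fun n =>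
    samplePoly_eq_expand (hext n) (m n)
  let T : ℕ → ℂ[X] := fun n => fallingWeight (p n) (m n) (N n)
  have hmonic : ∀ n, (p n).Monic := fun n => monic_prod_of_monic _ _ fun j _ => monic_X_sub_C _
  have hdeg : ∀ n, (p n).natDegree = n := fun n => by
    rw [natDegree_prod_of_monic _ _ fun j _ => monic_X_sub_C _]
    simp only [natDegree_X_sub_C, Finset.sum_const, Finset.card_range, smul_eq_mul, mul_one]
  have hTdeg : ∀ n, (T n).natDegree = n := fun n => natDegree_fallingWeight (hmonic n) (hdeg n) (hN n)
  have hTcard : ∀ n, (T n).roots.card = n := fun n => by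
    rw [← (IsAlgClosed.splits (T n)).natDegree_eq_card_roots, hTdeg]
  have hn : Tendsto (fun n : ℕ => (n : ℝ)) atTop atTop := tendsto_natCast_atTop_atTop
  have hm' : Tendsto (fun n : ℕ => (m n : ℝ)) atTop atTop := hn.comp hm
  choose w hw hwmono using fun n => exists_sorted_enumeration (T n).roots
  simp only [hTcard] at hw hwmono
  -- the radii of the roots of the derivative, and the radii read off from its coefficients
  let y : ℕ → ℕ → ℝ := fun n k => ‖w n k‖ ^ (m n : ℝ)⁻¹
  let x : ℕ → ℕ → ℝ := fun n k => r' n k * weightRatio (m n) (N n) k ^ (m n : ℝ)⁻¹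
  have hx0 : ∀ n k, 0 ≤ x n k := fun n k =>
    mul_nonneg (hnonneg n k) (Real.rpow_nonneg (weightRatio_nonneg _ _ _) _)
  have hy0 : ∀ n k, 0 ≤ y n k := fun n k => Real.rpow_nonneg (norm_nonneg _) _
  have hxlim : ∀ᵐ v : ℝ, v ∈ Ioo (0 : ℝ) 1 →
      Tendsto (fun n : ℕ => x n ⌊(n : ℝ) * v⌋₊) atTop (𝓝 (rootRadius ν₀ t v)) := by
    have hne : ∀ᵐ v : ℝ, v ≠ t := by simp [ae_iff]
    filter_upwards [tendsto_orderStatistic hsupp hmono hnonneg hext hlim, hne] with v h1 h2 hv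
    rw [rootRadius, mul_comm]
    exact (h1 hv).mul (tendsto_weightRatio hm ht.1 hv.1 h2)
  have hylim : ∀ᵐ v : ℝ, v ∈ Ioo (0 : ℝ) 1 →
      Tendsto (fun n : ℕ => y n ⌊(n : ℝ) * v⌋₊) atTop (𝓝 (rootRadius ν₀ t v)) := by
    have hξ := rootRadius_monotoneOn hsupp ht.1.le
    filter_upwards [ae_continuousAt_of_monotoneOn hξ] with v hv hmem
    refine tendsto_floor_of_continuousAt hy0 (fun n i j hij hj => ?_) hξ
      (fun v _ => rootRadius_nonneg _ _ _) (fun a b ha hab => ?_) hmem (hv hmem)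
    · exact Real.rpow_le_rpow (norm_nonneg _) (hwmono n i j hij hj) (by positivity)
    · have hX : Tendsto (fun n : ℕ => (n : ℝ)⁻¹ * ∑ k ∈ Finset.range n, logCut a b (x n k)) atTop
          (𝓝 (∫ v in (0 : ℝ)..1, logCut a b (rootRadius ν₀ t v))) := by
        refine tendsto_average tendsto_id (h := fun n k => logCut a b (x n k))
          (fun n k => abs_logCut_le_one ha hab _) ?_
        filter_upwards [hxlim] with v h1 h2
        exact ((continuous_logCut ha hab).tendsto _).comp (h1 h2)
      have hD : Tendsto (fun n : ℕ => (n : ℝ)⁻¹ * ∑ k ∈ Finset.range n, logCut a b (y n k) -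
          (n : ℝ)⁻¹ * ∑ k ∈ Finset.range n, logCut a b (x n k)) atTop (𝓝 0) := by
        have hz : Tendsto (fun n : ℕ => 2 * Real.log 2 / Real.log (b / a) * (m n : ℝ)⁻¹) atTop
            (𝓝 0) := by
          simpa using hm'.inv_tendsto_atTop.const_mul (2 * Real.log 2 / Real.log (b / a))
        refine squeeze_zero_norm' ?_ hz
        filter_upwards [eventually_gt_atTop 0, hm.eventually_gt_atTop 0] with n hn0 hm0
        have hmax : ∀ R : ℝ, 0 < R →
            (∏ j ∈ Finset.range n, max R (x n j) ^ m n =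
              ∏ j ∈ Finset.range n, max (R ^ m n) (r' n j ^ m n * weightRatio (m n) (N n) j)) ∧
            (∏ j ∈ Finset.range n, max R (y n j) ^ m n =
              ((T n).roots.map fun w => max (R ^ m n) ‖w‖).prod) := by
          intro R hR
          have hpow : ∀ z : ℝ, 0 ≤ z → max R z ^ m n = max (R ^ m n) (z ^ m n) := fun z hz => by
            rcases le_total R z with h | h
            · rw [max_eq_right h, max_eq_right (pow_le_pow_left₀ hR.le h _)]
            · rw [max_eq_left h, max_eq_left (pow_le_pow_left₀ hz h _)]
          constructor
          · refine Finset.prod_congr rfl fun j _ => ?_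
            rw [hpow _ (hx0 n j), mul_pow,
              Real.rpow_inv_natCast_pow (weightRatio_nonneg _ _ _) hm0.ne']
          · rw [hw n, Multiset.map_map]
            change _ = ∏ j ∈ Finset.range n, max (R ^ m n) ‖w n j‖
            refine Finset.prod_congr rfl fun j _ => ?_
            rw [hpow _ (hy0 n j), Real.rpow_inv_natCast_pow (norm_nonneg _) hm0.ne']
        have hcmp := fun R (hR : 0 < R) => prod_max_roots_fallingWeight (hnonneg n) (hmono n) (hN n)
          (pow_pos hR (m n))
        refine abs_average_logCut_sub_le hn0 hm0 (fun R hR => ?_) (fun R hR => ?_) ha hab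
        · rw [(hmax R hR).1, (hmax R hR).2]
          exact (hcmp R hR).1
        · rw [(hmax R hR).1, (hmax R hR).2]
          exact (hcmp R hR).2
      simpa using hD.add hX
  refine FiniteMeasure.tendsto_iff_forall_integral_tendsto.2 fun F => ?_
  have hFC : ∀ z, |F z| ≤ ‖F‖ := fun z => F.norm_coe_le_norm z
  change Tendsto _ _ (𝓝 (∫ z, F z ∂(rotInv (radialFlow ν₀ t))))
  rw [integral_rotInv_radialFlow hsupp ht]
  -- the average of `F` over the `m`-th roots of the `k`-th root of `T`
  let h : ℕ → ℕ → ℝ := fun n k => (m n : ℝ)⁻¹ * ∑ j ∈ Finset.range (m n), F ((y n k : ℂ) *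
    Complex.exp (((w n k).arg / m n + 2 * Real.pi * (j / m n) : ℝ) * Complex.I))
  have hhC : ∀ n k, |h n k| ≤ ‖F‖ := by
    intro n k
    rcases Nat.eq_zero_or_pos (m n) with h0 | h0
    · simp [h, h0]
    · have h0' : (0 : ℝ) < m n := Nat.cast_pos.2 h0
      simp only [h]
      rw [abs_mul, abs_of_pos (inv_pos.2 h0'), inv_mul_le_iff₀ h0']
      refine (Finset.abs_sum_le_sum_abs _ _).trans ((Finset.sum_le_sum fun j _ => hFC _).trans ?_)
      simp
  have havg : Tendsto (fun n : ℕ => (n : ℝ)⁻¹ * ∑ k ∈ Finset.range n, h n k) atTop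
      (𝓝 (∫ v in (0 : ℝ)..1, circleMean F (rootRadius ν₀ t v))) := by
    refine tendsto_average tendsto_id hhC ?_
    filter_upwards [hylim] with v h1 h2
    refine tendsto_average_circle F.continuous hFC hm (h1 h2) ?_
    refine squeeze_zero_norm (a := fun n => Real.pi * (m n : ℝ)⁻¹) (fun n => ?_) ?_
    · rw [norm_div, Real.norm_natCast, div_eq_mul_inv]
      exact mul_le_mul_of_nonneg_right (Complex.abs_arg_le_pi _) (by positivity)
    · simpa using hm'.inv_tendsto_atTop.const_mul Real.pi
  have hNlim : Tendsto (fun n => (N n : ℝ) / ((n : ℝ) * m n)) atTop (𝓝 t) :=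
    tendsto_floor_mul_div (hn.atTop_mul_atTop₀ hm') ht.1.le
  have hfinal : Tendsto (fun n : ℕ => (1 - (N n : ℝ) / ((n : ℝ) * m n))⁻¹ *
      ((n : ℝ)⁻¹ * ∑ k ∈ Finset.range n, h n k - (N n : ℝ) / ((n : ℝ) * m n) * F 0)) atTop
      (𝓝 ((1 - t)⁻¹ * ((∫ v in (0 : ℝ)..1, circleMean F (rootRadius ν₀ t v)) - t * F 0))) :=
    ((tendsto_const_nhds.sub hNlim).inv₀ (sub_pos.2 ht.2).ne').mul
      (havg.sub (hNlim.mul_const _))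
  refine hfinal.congr' ?_
  filter_upwards [eventually_gt_atTop 0, hm.eventually_gt_atTop 0] with n hn0 hm0
  have hn0' : (n : ℝ) ≠ 0 := Nat.cast_ne_zero.2 hn0.ne'
  have hm0' : (m n : ℝ) ≠ 0 := Nat.cast_ne_zero.2 hm0.ne'
  have hT0 : fallingWeight (p n) (m n) (N n) ≠ 0 := fun h0 => by
    have := hTdeg n
    simp only [T] at this
    rw [h0, natDegree_zero] at this
    omega
  have hsum : ∀ G : ℂ → ℝ,
      ((derivative^[N n] (samplePoly (r n) (m n))).roots.map G).sum =
        ∑ k ∈ Finset.range n, ((nthRoots (m n) (w n k)).map G).sum - N n * G 0 := by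
    intro G
    rw [hp, sum_roots_iterate_derivative G hm0 hT0]
    congr 1
    change (((T n).roots).map _).sum = _
    rw [hw n, Multiset.map_map]
    rfl
  have hcard : ((derivative^[N n] (samplePoly (r n) (m n))).roots.card : ℝ) =
      n * m n - N n := by
    have h1 := hsum fun _ => 1
    simp only [sum_nthRoots _ _ hm0] at h1
    simpa using h1
  rw [integral_empirical, hcard, hsum]
  have h2 : ∑ k ∈ Finset.range n, ((nthRoots (m n) (w n k)).map F).sum =
      m n * ∑ k ∈ Finset.range n, h n k := by
    rw [Finset.mul_sum]
    refine Finset.sum_congr rfl fun k _ => ?_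
    rw [sum_nthRoots _ _ hm0]
    simp only [h, y]
    rw [mul_inv_cancel_left₀ hm0']
  rw [h2]
  have h3 : (1 - (N n : ℝ) / ((n : ℝ) * m n)) = (n * m n - N n) * ((n : ℝ) * m n)⁻¹ := by
    field_simp
  rw [h3, mul_inv, inv_inv]
  field_simp

end Convergence

end RotDeriv

theorem theorem4p1 (ν₀ : Measure ℝ) [IsProbabilityMeasure ν₀]
    (hsupp : ∃ R : ℝ, ν₀ (Icc 0 R)ᶜ = 0) :
    -- convergence of the empirical root measures
    (∀ (r : (n : ℕ) → Fin n → ℝ),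
      (∀ n, Monotone (r n)) → (∀ n j, 0 ≤ r n j) →
      Tendsto (fun n => empirical (Finset.univ.val.map (r n))) atTop
        (𝓝 (toFin ν₀)) →
      ∀ m : ℕ → ℕ,
        Tendsto (fun n : ℕ => (m n : ℝ) / ((n : ℝ) * Real.log n)) atTop atTop →
        ∀ t ∈ Ioo (0 : ℝ) 1,
          Tendsto
            (fun n : ℕ =>
              empirical (derivative^[⌊(n : ℝ) * (m n : ℝ) * t⌋₊] (samplePoly (r n) (m n))).roots)
            atTop
            (𝓝 (toFin (rotInv (radialFlow ν₀ t))))) ∧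
    -- total mass, initial value and quantiles
    (∀ t ∈ Ico (0 : ℝ) 1, massFlow ν₀ t univ = ENNReal.ofReal (1 - t)) ∧
    massFlow ν₀ 0 = ν₀ ∧
    (∀ t ∈ Ioo (0 : ℝ) 1, ∀ x ∈ Icc 0 (1 - t),
      quantile (massFlow ν₀ t) x = x * quantile ν₀ (x + t) / (x + t)) ∧
    -- continuous and strictly increasing initial distribution function
    (∀ A : ℝ, 0 < A →
      ContinuousOn (distFun ν₀) (Icc 0 A) → StrictMonoOn (distFun ν₀) (Icc 0 A) →
      BijOn (distFun ν₀) (Icc 0 A) (Icc 0 1) →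
      InvOn (quantile ν₀) (distFun ν₀) (Icc 0 A) (Icc 0 1) ∧
      BijOn (quantile ν₀) (Icc 0 1) (Icc 0 A) ∧
      ∀ t ∈ Ioo (0 : ℝ) 1,
        ContinuousOn (Psi ν₀ t) (Icc 0 (A * (1 - t))) ∧
        StrictMonoOn (Psi ν₀ t) (Icc 0 (A * (1 - t))) ∧
        BijOn (Psi ν₀ t) (Icc 0 (A * (1 - t))) (Icc 0 (1 - t)) ∧
        InvOn (quantile (massFlow ν₀ t)) (Psi ν₀ t) (Icc 0 (A * (1 - t))) (Icc 0 (1 - t)) ∧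
        BijOn (quantile (massFlow ν₀ t)) (Icc 0 (1 - t)) (Icc 0 (A * (1 - t))) ∧
        ∀ x ∈ Ioo 0 (1 - t),
          Function.invFunOn (Psi ν₀ t) (Icc 0 (A * (1 - t))) x / x =
            Function.invFunOn (distFun ν₀) (Icc 0 A) (x + t) / (x + t)) ∧
    -- continuous and strictly positive initial density
    (∀ (A : ℝ) (ψ₀ : ℝ → ℝ), 0 < A → HasDensityOn ν₀ A ψ₀ →
      ContinuousOn ψ₀ (Ioo 0 A) → (∀ x ∈ Ioo 0 A, 0 < ψ₀ x) →
      (∀ t ∈ Ico (0 : ℝ) 1,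
        massFlow ν₀ t (Icc 0 (A * (1 - t)))ᶜ = 0 ∧
        Continuous (Psi ν₀ t) ∧
        (∀ x ∈ Ioo 0 (A * (1 - t)), HasDerivAt (Psi ν₀ t) (psi ν₀ t x) x ∧ 0 < psi ν₀ t x) ∧
        HasDensityOn (massFlow ν₀ t) (A * (1 - t)) (psi ν₀ t)) ∧
      ContDiffOn ℝ 1 (fun p : ℝ × ℝ => Psi ν₀ p.1 p.2) (region A) ∧
      (∀ t x : ℝ, (t, x) ∈ region A →
        HasDerivWithinAt (fun s => Psi ν₀ s x) (x * (psi ν₀ t x / Psi ν₀ t x) - 1)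
          (Ico 0 1) t) ∧
      -- continuously differentiable initial density
      (ContDiffOn ℝ 1 ψ₀ (Ioo 0 A) →
        ContDiffOn ℝ 1 (fun p : ℝ × ℝ => psi ν₀ p.1 p.2) (region A) ∧
        ∀ t x : ℝ, (t, x) ∈ region A →
          DifferentiableAt ℝ (fun y => psi ν₀ t y / ((1 / y) * ∫ u in (0 : ℝ)..y, psi ν₀ t u)) x ∧
          HasDerivWithinAt (fun s => psi ν₀ s x)
            (deriv (fun y => psi ν₀ t y / ((1 / y) * ∫ u in (0 : ℝ)..y, psi ν₀ t u)) x)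
            (Ico 0 1) t)) := by
  have h1 : ∀ m : ℕ → ℕ,
      Tendsto (fun n : ℕ => (m n : ℝ) / ((n : ℝ) * Real.log n)) atTop atTop →
      Tendsto m atTop atTop := by
    intro m hm
    refine (tendsto_natCast_atTop_iff (R := ℝ)).1 (tendsto_atTop_mono' atTop ?_ hm)
    have hlog : Tendsto (fun n : ℕ => (n : ℝ) * Real.log n) atTop atTop :=
      tendsto_natCast_atTop_atTop.atTop_mul_atTop₀
        (Real.tendsto_log_atTop.comp tendsto_natCast_atTop_atTop)
    filter_upwards [hlog.eventually_ge_atTop 1] with n hn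
    exact div_le_self (Nat.cast_nonneg _) hn
  refine ⟨fun r hr hr0 hlim m hm t ht => tendsto_empirical_roots hsupp hr hr0 hlim (h1 m hm) ht,
    fun t ht => massFlow_univ hsupp ht, massFlow_zero hsupp, fun t ht x hx => ?_,
    fun A hA _ hF hb => ?_, fun A ψ₀ hA hd hc hp => ?_⟩
  · rw [quantile_massFlow hsupp ⟨ht.1.le, ht.2⟩ hx,
      flowRadius_add ν₀ (add_pos_of_nonneg_of_pos hx.1 ht.1).ne']
  · refine ⟨invOn_quantile hF hb, bijOn_quantile hF hb, fun t ht => ?_⟩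
    have ht' : t ∈ Ico (0 : ℝ) 1 := ⟨ht.1.le, ht.2⟩
    have hB := bijOn_Psi hsupp hA hF hb ht'
    have hI := invOn_quantile_massFlow hsupp hA hF hb ht'
    exact ⟨continuousOn_Psi hsupp hA hF hb ht', strictMonoOn_Psi hsupp hA hF hb ht', hB, hI,
      hB.symm hI.symm, fun x hx => invFunOn_Psi_div hsupp hA hF hb ht' hx⟩
  · have H := hd.hasRegularQuantile hA hc hp
    refine ⟨fun t ht => ⟨H.massFlow_compl_Icc hsupp ht, H.continuous_Psi hsupp ht,
      fun x hx => ⟨?_, H.psi_pos hsupp ⟨ht, hx⟩⟩, H.hasDensityOn_massFlow hsupp ht⟩,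
      H.contDiffOn_Psi hsupp, fun t x hx => H.hasDerivWithinAt_Psi_eq hsupp hx, fun hc1 => ?_⟩
    · rw [H.psi_eq hsupp (t := t) (x := x) ⟨ht, hx⟩]
      exact H.hasDerivAt_Psi hsupp (t := t) (x := x) ⟨ht, hx⟩
    · have hq : ContDiffOn ℝ 2 (quantile ν₀) (Ioo 0 1) := by
        have := hd.contDiffOn_quantile hA hp 1 (by exact_mod_cast hc1)
        exact this.of_le (by norm_num)
      refine ⟨H.contDiffOn_psi hsupp hq, fun t x hx => ?_⟩
      have hD := H.hasDerivAt_psi_div_mean hsupp hq hx rfl rfl rfl rfl rfl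
      refine ⟨hD.differentiableAt, ?_⟩
      rw [hD.deriv]
      exact H.hasDerivWithinAt_psi hsupp hq hx rfl rfl rfl rfl rfl
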